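/- Let $\mathcal H$ be a complex Hilbert space, $H$ a self-adjoint (possibly unbounded) operator on $\mathcal H$, and $(L_\alpha)_\alpha$ a finite family of bounded operators on $\mathcal H$. On a probability space $(\Omega,\mathcal F,\mathbb P)$ let $(N_\alpha)_\alpha$ be independent standard (unit-rate) Poisson processes on $[0,\infty)$, and put $d\widetilde N_\alpha=dN_\alpha-dt$. Let $\varphi_0\in\mathcal H$ and let $(\psi_t)_{t\ge 0}$ be an $\mathcal H$-valued càdlàg process which solves the linear stochastic differential equation $$d\psi_t=\sum_\alpha L_\alpha\psi_{t-}\,d\widetilde N_\alpha(t)-\Big(iH+\tfrac12\sum_\alpha L_\alpha^\dagger L_\alpha\Big)\psi_t\,dt,\qquad \psi_0=\varphi_0$$ (the unnormalized Poisson unravelling), meaning that almost surely, for almost every $t$, $\psi_t$ lies in the domain of $H$, that $t\mapsto H\psi_t$ is locally integrable, and that the integrated equation holds for all $t\ge 0$. Let $$R_\alpha(t)=\frac{\langle\psi_t|\,L_\alpha+L_\alpha^\dagger+L_\alpha^\dagger L_\alpha\,|\psi_t\rangle}{\langle\psi_t|\psi_t\rangle},$$ with $R_\alpha(t)=0$ when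 $\psi_t=0$, and let $R_\alpha(t-)$ be the same expression with $\psi_t$ replaced by the left limit $\psi_{t-}$ (where $\psi_{0-}=\psi_0$). Then the following hold. 1. Almost surely, for all $t\ge 0$, $$\langle\psi_t|\psi_t\rangle=\|\varphi_0\|^2+\sum_\alpha\int_{(0,t]}R_\alpha(s-)\,\langle\psi_{s-}|\psi_{s-}\rangle\,d\widetilde N_\alpha(s),$$ that is, $d\langle\psi_t|\psi_t\rangle=\sum_\alpha R_\alpha\,d\widetilde N_\alpha\,\langle\psi_t|\psi_t\rangle$; all these integrals exist. 2. The process $X_t=\sum_\alpha\int_{(0,t]}R_\alpha(s-)\,d\widetilde N_\alpha(s)$ is well defined, and if $\|\varphi_0\|=1$ then the norm-squared process is the Doléans-Dade exponential of $X$, $$\langle\psi_t|\psi_t\rangle=\mathcal E\Big(\sum_\alpha\int_{(0,\cdot]}R_\alpha(s-)\,d\widetilde N_\alpha(s)\Big)_t .$$ That is, almost surely $t\mapsto\langle\psi_t|\psi_t\rangle$ is the unique càdlàg solution $Z$ of $Z_t=1+\int_{(0,t]}Z_{s-}\,dX_s$, $t\ge 0$. -/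

import Mathlib

open MeasureTheory ProbabilityTheory Filter Set
open scoped NNReal ENNReal Topology Nat InnerProductSpace

/-- A path is càdlàg: right-continuous on `[0, ∞)`, with a left limit at every time. -/
structure IsCadlag {E : Type*} [TopologicalSpace E] (u : ℝ≥0 → E) : Prop where
  right_continuous : ∀ t, ContinuousWithinAt u (Ici t) t
  left_limit : ∀ t, ∃ l, Tendsto u (𝓝[<] t) (𝓝 l)

/-- Lebesgue measure on the time half-line `[0, ∞)`. -/
noncomputable def lebesgueTime : Measure ℝ≥0 :=
  Measure.comap (fun t : ℝ≥0 => (t : ℝ)) volume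

/-- `N` is a Poisson random measure on `T` with intensity measure `ν`, under the probability
measure `P`: it takes values in `{0, 1, 2, …} ∪ {∞}`, the mass of a set of finite intensity is
Poisson distributed, and the masses of pairwise disjoint sets are independent. -/
structure IsPoissonRandomMeasure {Ω T : Type*} [MeasurableSpace Ω] [MeasurableSpace T]
    (N : Ω → Measure T) (ν : Measure T) (P : Measure Ω) : Prop where
  measurable : Measurable N
  integer_valued : ∀ ω A, MeasurableSet A → ∃ k : ℕ∞, N ω A = (k : ℝ≥0∞)
  law : ∀ A, MeasurableSet A → ν A ≠ ∞ → ∀ k : ℕ,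
    P.real {ω | N ω A = (k : ℝ≥0∞)} = (ν A).toReal ^ k / (k ! : ℝ) * Real.exp (-(ν A).toReal)
  indep : ∀ (m : ℕ) (A : Fin m → Set T), (∀ i, MeasurableSet (A i)) →
    Pairwise (fun i j => Disjoint (A i) (A j)) → iIndepFun (fun i ω => N ω (A i)) P

/-- A finite family of independent standard Poisson processes: independent Poisson random measures
on the half-line of times `[0, ∞)`, each with Lebesgue measure as its intensity. The counting
process is `t ↦ N α ω [0, t]`. -/
structure IsStandardPoissonFamily {Ω ι : Type*} [MeasurableSpace Ω]
    (N : ι → Ω → Measure ℝ≥0) (P : Measure Ω) : Prop where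
  poisson : ∀ α, IsPoissonRandomMeasure (N α) lebesgueTime P
  indep : iIndepFun N P

section PathwiseIntegrals

variable {E : Type*} [NormedAddCommGroup E] [NormedSpace ℝ E]

/-- The integrand `f` can be integrated over `(0, t]` against `dÑ = dn - ds`. -/
def CompIntegrable (n : Measure ℝ≥0) (f : ℝ≥0 → E) (t : ℝ≥0) : Prop :=
  IntegrableOn f (Ioc 0 t) n ∧ IntegrableOn f (Ioc 0 t) lebesgueTime

/-- The integral `∫_{(0,t]} f dÑ = ∫_{(0,t]} f dn - ∫_0^t f ds` of the path `f` against one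
realization `n` of a standard Poisson process, compensated. -/
noncomputable def compIntegral (n : Measure ℝ≥0) (f : ℝ≥0 → E) (t : ℝ≥0) : E :=
  (∫ s in Ioc 0 t, f s ∂n) - ∫ s in Ioc 0 t, f s ∂lebesgueTime

end PathwiseIntegrals

/-- `I` is the Lebesgue–Stieltjes integral `∫_{(0,t]} f dx`, where `x` is a right-continuous path
of finite variation on `[0, t]`: `dx` is represented there as a difference `μ - ν` of two finite
measures. (The value of the integral does not depend on the representation.) -/
def IsStieltjesIntegral (f x : ℝ≥0 → ℝ) (t : ℝ≥0) (I : ℝ) : Prop :=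
  ∃ μ ν : Measure ℝ≥0, IsFiniteMeasure μ ∧ IsFiniteMeasure ν ∧
    (∀ a b, a ≤ b → b ≤ t → x b - x a = μ.real (Ioc a b) - ν.real (Ioc a b)) ∧
    IntegrableOn f (Ioc 0 t) μ ∧ IntegrableOn f (Ioc 0 t) ν ∧
    I = (∫ s in Ioc 0 t, f s ∂μ) - ∫ s in Ioc 0 t, f s ∂ν

/-- The càdlàg path `z` solves `z_t = 1 + ∫_{(0,t]} z_{s-} dx_s` for all `t`. -/
structure SolvesExponentialEq (x z : ℝ≥0 → ℝ) : Prop where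
  cadlag : IsCadlag z
  initial : z 0 = 1
  eq : ∀ t, IsStieltjesIntegral (Function.leftLim z) x t (z t - 1)

/-- `z` is the Doléans-Dade exponential `ℰ(x)` of the finite variation path `x`: the unique càdlàg
solution of `dz = z_- dx`, `z_0 = 1`. -/
def IsDoleansDade (x z : ℝ≥0 → ℝ) : Prop :=
  SolvesExponentialEq x z ∧ ∀ z', SolvesExponentialEq x z' → z' = z

section Unravelling

variable {𝓗 ι : Type*} [NormedAddCommGroup 𝓗] [InnerProductSpace ℂ 𝓗] [CompleteSpace 𝓗] [Fintype ι]

/-- The path `u` in the system Hilbert space solves, for the realization `n` of the Poisson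
processes, the linear equation
`du = ∑ α, L α u_- dÑ_α - (i H + (1/2) ∑ α, (L α)† (L α)) u dt`, `u_0 = φ₀`,
in integrated form. The self-adjoint operator `H` may be unbounded; the path `h` is `s ↦ H u_s`,
and `u_s` is to be in the domain of `H` for almost every `s`. -/
def SolvesUnravelling (H : 𝓗 →ₗ.[ℂ] 𝓗) (L : ι → 𝓗 →L[ℂ] 𝓗) (φ₀ : 𝓗)
    (n : ι → Measure ℝ≥0) (u : ℝ≥0 → 𝓗) : Prop :=
  IsCadlag u ∧
  ∃ h : ℝ≥0 → 𝓗, (∀ᵐ s ∂lebesgueTime, (u s, h s) ∈ H.graph) ∧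
    ∀ t, IntegrableOn h (Ioc 0 t) lebesgueTime ∧
      u t = φ₀ + ∑ α, compIntegral (n α) (fun s => L α (Function.leftLim u s)) t
        - ∫ s in Ioc 0 t, (Complex.I • h s
            + (1 / 2 : ℂ) • ∑ α, (ContinuousLinearMap.adjoint (L α)) (L α (u s))) ∂lebesgueTime

/-- `R = ⟨v| L + L† + L† L |v⟩ / ⟨v|v⟩`, with value `0` at `v = 0`. The numerator is real, since
the operator is self-adjoint. -/
noncomputable def jumpRate (L : 𝓗 →L[ℂ] 𝓗) (v : 𝓗) : ℝ :=
  (⟪v, (L + ContinuousLinearMap.adjoint L + ContinuousLinearMap.adjoint L ∘L L) v⟫_ℂ).re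
    / (⟪v, v⟫_ℂ).re

/-- The path `s ↦ R_α(s-)` along `u`. -/
noncomputable def ratePath (L : 𝓗 →L[ℂ] 𝓗) (u : ℝ≥0 → 𝓗) (s : ℝ≥0) : ℝ :=
  jumpRate L (Function.leftLim u s)

/-- The norm-squared path `t ↦ ⟨u_t|u_t⟩`. -/
noncomputable def normSqPath (u : ℝ≥0 → 𝓗) (t : ℝ≥0) : ℝ := (⟪u t, u t⟫_ℂ).re

end Unravelling

/-! The argument is pathwise; probability enters only through the geometry of the Poisson points.
Almost surely each realization is locally finite and purely atomic, its positive atoms have mass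
one, and no two processes jump at the same positive time
(`IsStandardPoissonFamily.ae_isSimpleFamily`). For such a realization every integral is an ordinary
Lebesgue integral.

Put `M = dt + ∑ α, n α`. The jump sets are disjoint and Lebesgue-null, so all jump terms and the
drift merge into one density: `u t = φ₀ + ∫ G dM` over `(0, t]`, with `G = L α u_-` at jumps of `n
α` and `G` equal to the compensated drift elsewhere. The product formula `norm_sq_add_integral_Ioc`
says that `‖u‖²` has `M`-density `2 Re⟨u_-, G⟩ + M{s} ‖G‖²`. At a jump this is `2 Re⟨u_-, L u_-⟩ +
‖L u_-‖² = R_α(s-) ‖u_-‖²`. Off the jumps the atom term vanishes, `H` drops out because `⟨u, H u⟩`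
is real, and the rest is `-∑ α, R_α ‖u‖²`, exactly the compensator.

For the exponential, `|R_α| ≤ 2‖L α‖ + ‖L α‖²` makes `X` an indefinite integral of a locally
integrable density. The same identity then reads `z = 1 + ∫ z_- dX`, and a contraction argument for
the homogeneous equation (`IsCadlag.eq_zero_of_integral_eq`) gives uniqueness. -/

/-! ### Lebesgue measure on the half-line. -/

section LebesgueTime

theorem measurableEmbedding_nnreal_coe : MeasurableEmbedding (fun t : ℝ≥0 => (t : ℝ)) :=
  MeasurableEmbedding.subtype_coe measurableSet_Ici

theorem lebesgueTime_apply (A : Set ℝ≥0) :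
    lebesgueTime A = volume ((fun t : ℝ≥0 => (t : ℝ)) '' A) :=
  measurableEmbedding_nnreal_coe.comap_apply _ _

theorem lebesgueTime_Ioc (a b : ℝ≥0) : lebesgueTime (Ioc a b) = ENNReal.ofReal (b - a) := by
  rw [lebesgueTime_apply]
  have : (fun t : ℝ≥0 => (t : ℝ)) '' Ioc a b = Ioc (a : ℝ) b := by
    ext x
    constructor
    · rintro ⟨y, hy, rfl⟩
      exact ⟨NNReal.coe_lt_coe.2 hy.1, NNReal.coe_le_coe.2 hy.2⟩
    · intro hx
      have h0 : 0 ≤ x := a.coe_nonneg.trans hx.1.le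
      exact ⟨⟨x, h0⟩, ⟨NNReal.coe_lt_coe.1 hx.1, NNReal.coe_le_coe.1 hx.2⟩, rfl⟩
  rw [this, Real.volume_Ioc]

instance : NullSingletonClass lebesgueTime :=
  ⟨fun x => by rw [lebesgueTime_apply, image_singleton, Real.volume_singleton]⟩

theorem lebesgueTime_Iic (t : ℝ≥0) : lebesgueTime (Iic t) = ENNReal.ofReal t := by
  have h : Iic t = {0} ∪ Ioc 0 t := by
    ext x
    simp only [mem_Iic, mem_union, mem_singleton_iff, mem_Ioc, pos_iff_ne_zero]
    by_cases hx : x = 0 <;> simp [hx]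
  rw [h, measure_union (by simp) measurableSet_Ioc]
  simp [lebesgueTime_Ioc]

theorem isLocallyFiniteMeasure_of_Iic {m : Measure ℝ≥0} (h : ∀ t, m (Iic t) < ∞) :
    IsLocallyFiniteMeasure m :=
  ⟨fun x => ⟨Iic (x + 1), Iic_mem_nhds (by simp), h _⟩⟩

instance : IsLocallyFiniteMeasure lebesgueTime :=
  isLocallyFiniteMeasure_of_Iic fun t => by simp [lebesgueTime_Iic]

end LebesgueTime

/-! ### Càdlàg paths: left limits, measurability, local boundedness. -/

theorem nhdsLT_neBot_of_pos {t : ℝ≥0} (ht : 0 < t) : (𝓝[<] t).NeBot :=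
  nhdsLT_neBot_of_exists_lt ⟨0, ht⟩

theorem leftLim_zero {E : Type*} [TopologicalSpace E] (u : ℝ≥0 → E) :
    Function.leftLim u 0 = u 0 :=
  leftLim_eq_of_isBot isBot_bot

namespace IsCadlag

section

variable {E : Type*} [TopologicalSpace E] {u : ℝ≥0 → E}

theorem tendsto_leftLim (hu : IsCadlag u) (t : ℝ≥0) :
    Tendsto u (𝓝[<] t) (𝓝 (Function.leftLim u t)) :=
  tendsto_leftLim_of_tendsto (hu.left_limit t)

theorem leftLim_comp [T2Space E] {F : Type*} [TopologicalSpace F] [T2Space F] (hu : IsCadlag u)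
    {f : E → F} (hf : Continuous f) (t : ℝ≥0) :
    Function.leftLim (fun s => f (u s)) t = f (Function.leftLim u t) := by
  rcases eq_or_ne t 0 with rfl | ht
  · simp [leftLim_zero]
  · have := nhdsLT_neBot_of_pos (pos_iff_ne_zero.2 ht)
    exact leftLim_eq_of_tendsto ((hf.tendsto _).comp (hu.tendsto_leftLim t))

theorem comp {F : Type*} [TopologicalSpace F] (hu : IsCadlag u) {f : E → F} (hf : Continuous f) :
    IsCadlag (fun s => f (u s)) where
  right_continuous t := hf.continuousAt.comp_continuousWithinAt (hu.right_continuous t)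
  left_limit t := ⟨_, (hf.tendsto _).comp (hu.tendsto_leftLim t)⟩

end

section Measurable

variable {E : Type*} [TopologicalSpace E] [TopologicalSpace.PseudoMetrizableSpace E] {u : ℝ≥0 → E}

/-- Sampling at the next grid point `r n s ≥ s` of mesh `1/(n+1)` gives functions that factor
through a countable set; right-continuity makes them converge to `u`. -/
theorem stronglyMeasurable (hu : IsCadlag u) : StronglyMeasurable u := by
  let r : ℕ → ℝ≥0 → ℝ≥0 := fun n s => (⌊((n : ℝ≥0) + 1) * s⌋₊ + 1 : ℕ) / ((n : ℝ≥0) + 1)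
  have hr : ∀ n, StronglyMeasurable fun s => u (r n s) := fun n => by
    have h1 : Measurable fun s : ℝ≥0 => ⌊((n : ℝ≥0) + 1) * s⌋₊ :=
      Nat.measurable_floor.comp (measurable_const.mul measurable_id)
    have h2 : StronglyMeasurable fun k : ℕ => u ((k + 1 : ℕ) / ((n : ℝ≥0) + 1)) :=
      StronglyMeasurable.of_discrete
    exact h2.comp_measurable h1
  refine stronglyMeasurable_of_tendsto atTop hr ?_
  rw [tendsto_pi_nhds]
  intro s
  refine Tendsto.comp (hu.right_continuous s) ?_
  have hge : ∀ n, s ≤ r n s := fun n => by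
    have := (Nat.lt_floor_add_one (((n : ℝ≥0) + 1) * s)).le
    rw [le_div_iff₀ (by positivity)]
    push_cast; linarith
  refine tendsto_nhdsWithin_iff.2 ⟨?_, Eventually.of_forall hge⟩
  have hle : ∀ n, r n s ≤ s + 1 / ((n : ℝ≥0) + 1) := fun n => by
    have := Nat.floor_le (zero_le (a := ((n : ℝ≥0) + 1) * s))
    simp only [r]
    rw [div_le_iff₀ (by positivity), add_mul s, div_mul_cancel₀ _ (by positivity)]
    push_cast; linarith
  refine tendsto_of_tendsto_of_tendsto_of_le_of_le tendsto_const_nhds ?_ hge hle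
  simpa using (tendsto_const_nhds (x := s)).add
    (tendsto_one_div_add_atTop_nhds_zero_nat (𝕜 := ℝ≥0))

/-- Here the grid point must lie strictly below `s`, even when `s` is itself on the grid; hence
ceiling minus one rather than floor. -/
theorem stronglyMeasurable_leftLim (hu : IsCadlag u) :
    StronglyMeasurable (Function.leftLim u) := by
  let r : ℕ → ℝ≥0 → ℝ≥0 := fun n s => (⌈((n : ℝ≥0) + 1) * s⌉₊ - 1 : ℕ) / ((n : ℝ≥0) + 1)
  have hr : ∀ n, StronglyMeasurable fun s => u (r n s) := fun n => by
    have h1 : Measurable fun s : ℝ≥0 => ⌈((n : ℝ≥0) + 1) * s⌉₊ :=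
      Nat.measurable_ceil.comp (measurable_const.mul measurable_id)
    have h2 : StronglyMeasurable fun k : ℕ => u ((k - 1 : ℕ) / ((n : ℝ≥0) + 1)) :=
      StronglyMeasurable.of_discrete
    exact h2.comp_measurable h1
  refine stronglyMeasurable_of_tendsto atTop hr ?_
  rw [tendsto_pi_nhds]
  intro s
  rcases eq_or_ne s 0 with rfl | hs
  · simpa [r, leftLim_zero] using tendsto_const_nhds
  refine Tendsto.comp (hu.tendsto_leftLim s) ?_
  have hk : ∀ n : ℕ, ∃ k : ℕ, ⌈((n : ℝ≥0) + 1) * s⌉₊ = k + 1 := fun n =>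
    Nat.exists_eq_succ_of_ne_zero (Nat.ceil_pos.2 (by positivity)).ne'
  have hlt : ∀ n, r n s < s := fun n => by
    obtain ⟨k, hk⟩ := hk n
    have := Nat.ceil_lt_add_one (zero_le (a := ((n : ℝ≥0) + 1) * s))
    simp only [r]
    rw [div_lt_iff₀ (by positivity)]
    rw [hk] at this ⊢
    push_cast at this ⊢
    rw [mul_comm]
    simpa using this
  refine tendsto_nhdsWithin_iff.2 ⟨?_, Eventually.of_forall hlt⟩
  have hle : ∀ n : ℕ, s - 1 / ((n : ℝ≥0) + 1) ≤ r n s := fun n => by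
    obtain ⟨k, hk⟩ := hk n
    have := Nat.le_ceil (((n : ℝ≥0) + 1) * s)
    simp only [r]
    rw [tsub_le_iff_right, ← add_div, le_div_iff₀ (by positivity)]
    rw [hk] at this ⊢
    push_cast at this ⊢
    rw [mul_comm]
    simpa using this
  refine tendsto_of_tendsto_of_tendsto_of_le_of_le ?_ tendsto_const_nhds hle fun n => (hlt n).le
  simpa using (tendsto_const_nhds (x := s)).sub
    (tendsto_one_div_add_atTop_nhds_zero_nat (𝕜 := ℝ≥0))

end Measurable

section Bounded

variable {E : Type*} [NormedAddCommGroup E] {u : ℝ≥0 → E}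

/-- Each time has a bounded neighbourhood, by the left limit on one side and right-continuity on the
other; compactness of `[0, T]` does the rest. -/
theorem exists_norm_le (hu : IsCadlag u) (T : ℝ≥0) : ∃ C, 0 ≤ C ∧ ∀ t ≤ T, ‖u t‖ ≤ C := by
  have key : ∃ C, ∀ t ∈ Icc 0 T, ‖u t‖ ≤ C := by
    refine isCompact_Icc.induction_on (p := fun A => ∃ C, ∀ t ∈ A, ‖u t‖ ≤ C) ?_ ?_ ?_ ?_
    · exact ⟨0, by simp⟩
    · rintro A B hAB ⟨C, hC⟩
      exact ⟨C, fun t ht => hC t (hAB ht)⟩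
    · rintro A B ⟨C, hC⟩ ⟨D, hD⟩
      exact ⟨max C D, fun t ht => ht.elim (fun h => (hC t h).trans (le_max_left _ _))
        fun h => (hD t h).trans (le_max_right _ _)⟩
    · intro x _
      obtain ⟨C, hC⟩ := (hu.right_continuous x).norm.isBoundedUnder_le
      obtain ⟨D, hD⟩ := (hu.tendsto_leftLim x).norm.isBoundedUnder_le
      rw [eventually_map] at hC hD
      have h : ∀ᶠ y in 𝓝 x, ‖u y‖ ≤ max C D := by
        rw [← nhdsLT_sup_nhdsGE, eventually_sup]
        exact ⟨hD.mono fun y h => h.trans (le_max_right _ _),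
          hC.mono fun y h => h.trans (le_max_left _ _)⟩
      exact ⟨_, mem_nhdsWithin_of_mem_nhds h, max C D, fun t ht => ht⟩
  obtain ⟨C, hC⟩ := key
  exact ⟨C, (norm_nonneg _).trans (hC 0 (by simp)), fun t ht => hC t ⟨zero_le, ht⟩⟩

theorem norm_leftLim_le (hu : IsCadlag u) {a s : ℝ≥0} (has : a < s) {C : ℝ}
    (h : ∀ t, a < t → t < s → ‖u t‖ ≤ C) : ‖Function.leftLim u s‖ ≤ C := by
  have := nhdsLT_neBot_of_pos (zero_le.trans_lt has)
  refine le_of_tendsto (hu.tendsto_leftLim s).norm ?_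
  filter_upwards [Ioo_mem_nhdsLT has] with t ht using h t ht.1 ht.2

theorem exists_norm_leftLim_le (hu : IsCadlag u) (T : ℝ≥0) :
    ∃ C, 0 ≤ C ∧ ∀ t ≤ T, ‖Function.leftLim u t‖ ≤ C := by
  obtain ⟨C, h0, hC⟩ := hu.exists_norm_le T
  refine ⟨C, h0, fun t ht => ?_⟩
  rcases eq_or_ne t 0 with rfl | h
  · rw [leftLim_zero]; exact hC 0 ht
  · exact hu.norm_leftLim_le (pos_iff_ne_zero.2 h) fun s _ hs => hC s (hs.le.trans ht)

end Bounded

end IsCadlag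

theorem integrableOn_Ioc_of_bounded {E : Type*} [NormedAddCommGroup E] {m : Measure ℝ≥0}
    (hm : ∀ t, m (Iic t) < ∞) {f : ℝ≥0 → E} (hf : StronglyMeasurable f) {t : ℝ≥0}
    (hb : ∃ C, 0 ≤ C ∧ ∀ s ≤ t, ‖f s‖ ≤ C) : IntegrableOn f (Ioc 0 t) m := by
  obtain ⟨C, -, hC⟩ := hb
  have : IsFiniteMeasure (m.restrict (Ioc 0 t)) :=
    ⟨by simpa using (measure_mono Ioc_subset_Iic_self).trans_lt (hm t)⟩
  refine Integrable.of_bound hf.aestronglyMeasurable C ?_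
  filter_upwards [ae_restrict_mem measurableSet_Ioc] with s hs using hC s hs.2

/-! ### Almost every Poisson realization is simple. -/

/-- A family of locally finite counting measures on the half-line, each of them carried by atoms,
whose atoms in `(0, ∞)` have mass one and are not shared between members of the family. -/
structure IsSimpleFamily {ι : Type*} (n : ι → Measure ℝ≥0) : Prop where
  finite : ∀ α t, n α (Iic t) < ∞
  carried : ∀ α, n α {s | n α {s} = 0} = 0
  unit : ∀ α s, 0 < s → n α {s} ≠ 0 → n α {s} = 1
  disjoint : ∀ α β s, 0 < s → n α {s} ≠ 0 → n β {s} ≠ 0 → α = β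

/-- By outer regularity a point of mass zero has an open neighbourhood of mass below one, hence of
mass zero by integrality. So the set of such points is locally null. -/
theorem measure_nonatoms_eq_zero {m : Measure ℝ≥0} (hfin : ∀ t, m (Iic t) < ∞)
    (hint : ∀ A, MeasurableSet A → ∃ k : ℕ∞, m A = (k : ℝ≥0∞)) : m {s | m {s} = 0} = 0 := by
  have := isLocallyFiniteMeasure_of_Iic hfin
  refine measure_null_of_locally_null _ fun s hs => ?_
  obtain ⟨U, hsU, hU, hlt⟩ := Set.exists_isOpen_lt_of_lt {s} 1 (μ := m)
    (by rw [mem_ofPred_eq] at hs; rw [hs]; exact one_pos)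
  refine ⟨U, mem_nhdsWithin_of_mem_nhds (hU.mem_nhds (hsU rfl)), ?_⟩
  obtain ⟨k, hk⟩ := hint U hU.measurableSet
  rw [hk] at hlt ⊢
  have h1 : k < 1 := by exact_mod_cast hlt
  simp [Order.lt_one_iff.1 h1]

/-- A property of sets of times that holds on each short interval with probability at most the
square of its length holds almost surely at no single positive time. -/
theorem ae_forall_singleton_notMem {Ω : Type*} [MeasurableSpace Ω] {P : Measure Ω}
    (E : Set ℝ≥0 → Set Ω) (hE : ∀ A B, A ⊆ B → E A ⊆ E B)
    (hP : ∀ a b : ℝ≥0, a ≤ b → P (E (Ioc a b)) ≤ ENNReal.ofReal (((b : ℝ) - a) ^ 2)) :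
    ∀ᵐ ω ∂P, ∀ s : ℝ≥0, 0 < s → ω ∉ E {s} := by
  have key : ∀ K : ℕ, P {ω | ∃ s : ℝ≥0, 0 < s ∧ s ≤ K ∧ ω ∈ E {s}} = 0 := fun K => by
    have hb : ∀ m : ℕ, P {ω | ∃ s : ℝ≥0, 0 < s ∧ s ≤ K ∧ ω ∈ E {s}}
        ≤ ENNReal.ofReal (K * (1 / ((m : ℝ) + 1))) := fun m => by
      -- `K (m+1)` cells of length `1/(m+1)` cover `(0, K]`, so the union bound is `K/(m+1)`, which
      -- tends to zero. The cells are closed on the right, so the cell of `s` has index `⌈(m+1)s⌉ -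
      -- 1`.
      let I : ℕ → Set ℝ≥0 := fun i => Ioc (i / ((m : ℝ≥0) + 1)) ((i + 1) / ((m : ℝ≥0) + 1))
      have hsub : {ω | ∃ s : ℝ≥0, 0 < s ∧ s ≤ K ∧ ω ∈ E {s}}
          ⊆ ⋃ i ∈ Finset.range (K * (m + 1)), E (I i) := by
        rintro ω ⟨s, h0, hK, hs⟩
        obtain ⟨k, hk⟩ : ∃ k : ℕ, ⌈((m : ℝ≥0) + 1) * s⌉₊ = k + 1 :=
          Nat.exists_eq_succ_of_ne_zero (Nat.ceil_pos.2 (by positivity)).ne'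
        have h1 := Nat.le_ceil (((m : ℝ≥0) + 1) * s)
        have h2 := Nat.ceil_lt_add_one (zero_le (a := ((m : ℝ≥0) + 1) * s))
        rw [hk] at h1 h2
        push_cast at h1 h2
        have h3 : (k : ℝ≥0) < ((m : ℝ≥0) + 1) * s := by simpa using h2
        refine mem_biUnion (x := k) ?_ (hE {s} (I k) (singleton_subset_iff.2 ⟨?_, ?_⟩) hs)
        · have h4 : (k : ℝ≥0) < (K * (m + 1) : ℕ) := by
            push_cast
            rw [mul_comm]
            exact h3.trans_le (mul_le_mul_right hK _)
          simpa using (Nat.cast_lt.1 h4)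
        · rw [div_lt_iff₀ (by positivity), mul_comm]; exact h3
        · rw [le_div_iff₀ (by positivity), mul_comm]; exact h1
      calc _ ≤ P (⋃ i ∈ Finset.range (K * (m + 1)), E (I i)) := measure_mono hsub
        _ ≤ ∑ i ∈ Finset.range (K * (m + 1)), P (E (I i)) := measure_biUnion_finset_le _ _
        _ ≤ ∑ i ∈ Finset.range (K * (m + 1)), ENNReal.ofReal ((1 / ((m : ℝ) + 1)) ^ 2) := by
          refine Finset.sum_le_sum fun i _ => (hP _ _ (by gcongr; simp)).trans_eq ?_
          congr 2
          push_cast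
          ring
        _ = ENNReal.ofReal (K * (1 / ((m : ℝ) + 1))) := by
          rw [Finset.sum_const, Finset.card_range, nsmul_eq_mul, ← ENNReal.ofReal_natCast,
            ← ENNReal.ofReal_mul (by positivity)]
          congr 1
          push_cast
          field_simp
    refine le_antisymm (ge_of_tendsto' (x := atTop) ?_ hb) zero_le
    rw [← ENNReal.ofReal_zero]
    refine ENNReal.tendsto_ofReal ?_
    simpa using (tendsto_const_nhds (x := (K : ℝ))).mul
      (tendsto_one_div_add_atTop_nhds_zero_nat (𝕜 := ℝ))
  have hall : ∀ᵐ ω ∂P, ∀ K : ℕ, ¬ ∃ s : ℝ≥0, 0 < s ∧ s ≤ K ∧ ω ∈ E {s} :=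
    ae_all_iff.2 fun K => by rw [ae_iff]; simpa using key K
  filter_upwards [hall] with ω h s hs hmem
  obtain ⟨K, hK⟩ := exists_nat_ge s
  exact h K ⟨s, hs, hK, hmem⟩

namespace IsPoissonRandomMeasure

variable {Ω : Type*} [MeasurableSpace Ω] {P : Measure Ω} {N : Ω → Measure ℝ≥0}

theorem measurableSet_eq (h : IsPoissonRandomMeasure N lebesgueTime P) {A : Set ℝ≥0}
    (hA : MeasurableSet A) (c : ℝ≥0∞) : MeasurableSet {ω | N ω A = c} :=
  ((Measure.measurable_coe hA).comp h.measurable) (measurableSet_singleton c)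

/-- The Poisson weights sum to one, which leaves no probability for the value `∞`. -/
theorem ae_lt_top [IsProbabilityMeasure P]
    (h : IsPoissonRandomMeasure N lebesgueTime P) {A : Set ℝ≥0}
    (hA : MeasurableSet A) (hfin : lebesgueTime A ≠ ∞) : ∀ᵐ ω ∂P, N ω A < ∞ := by
  have hsum : P (⋃ k : ℕ, {ω | N ω A = (k : ℝ≥0∞)}) = 1 := by
    rw [measure_iUnion _ fun k => h.measurableSet_eq hA _]
    · have h1 : ∀ k : ℕ, P {ω | N ω A = (k : ℝ≥0∞)}
          = ENNReal.ofReal (Real.exp (-(lebesgueTime A).toNNReal)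
            * (lebesgueTime A).toNNReal ^ k / k !) := fun k => by
        rw [← ofReal_measureReal, h.law A hA hfin k]
        congr 1
        simp only [ENNReal.coe_toNNReal_eq_toReal]
        ring
      simp_rw [h1]
      rw [← ENNReal.ofReal_tsum_of_nonneg (fun _ => by positivity)
        (hasSum_one_poissonMeasure _).summable, (hasSum_one_poissonMeasure _).tsum_eq, ENNReal.ofReal_one]
    · intro i j hij
      refine Set.disjoint_left.2 fun ω hi hj => hij ?_
      rw [mem_ofPred_eq] at hi hj
      exact_mod_cast hi.symm.trans hj
  have hmeas : MeasurableSet (⋃ k : ℕ, {ω | N ω A = (k : ℝ≥0∞)}) :=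
    MeasurableSet.iUnion fun k => h.measurableSet_eq hA _
  have hae : ∀ᵐ ω ∂P, ω ∈ ⋃ k : ℕ, {ω | N ω A = (k : ℝ≥0∞)} :=
    (mem_ae_iff_prob_eq_one hmeas).2 hsum
  filter_upwards [hae] with ω hω
  obtain ⟨k, hk⟩ := mem_iUnion.1 hω
  rw [mem_ofPred_eq] at hk
  rw [hk]
  exact ENNReal.natCast_lt_top k

theorem ae_forall_Iic_lt_top [IsProbabilityMeasure P]
    (h : IsPoissonRandomMeasure N lebesgueTime P) :
    ∀ᵐ ω ∂P, ∀ t, N ω (Iic t) < ∞ := by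
  have : ∀ᵐ ω ∂P, ∀ K : ℕ, N ω (Iic (K : ℝ≥0)) < ∞ :=
    ae_all_iff.2 fun K => h.ae_lt_top measurableSet_Iic (by simp [lebesgueTime_Iic])
  filter_upwards [this] with ω hω t
  obtain ⟨K, hK⟩ := exists_nat_ge t
  exact (measure_mono (Iic_subset_Iic.2 hK)).trans_lt (hω K)

theorem prob_Ioc_eq (h : IsPoissonRandomMeasure N lebesgueTime P) {a b : ℝ≥0} (hab : a ≤ b)
    (k : ℕ) : P.real {ω | N ω (Ioc a b) = k}
      = ((b : ℝ) - a) ^ k / (k ! : ℝ) * Real.exp (-((b : ℝ) - a)) := by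
  have h0 : (0 : ℝ) ≤ (b : ℝ) - a := sub_nonneg.2 (NNReal.coe_le_coe.2 hab)
  have := h.law (Ioc a b) measurableSet_Ioc (by simp [lebesgueTime_Ioc]) k
  rwa [lebesgueTime_Ioc, ENNReal.toReal_ofReal h0] at this

theorem prob_Ioc_ne_zero_le [IsProbabilityMeasure P]
    (h : IsPoissonRandomMeasure N lebesgueTime P) {a b : ℝ≥0}
    (hab : a ≤ b) : P.real {ω | N ω (Ioc a b) ≠ 0} ≤ (b : ℝ) - a := by
  have h1 := h.prob_Ioc_eq hab 0
  have h2 := Real.one_sub_le_exp_neg ((b : ℝ) - a)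
  have h3 := probReal_compl_eq_one_sub (μ := P)
    (h.measurableSet_eq (measurableSet_Ioc (a := a) (b := b)) 0)
  have h4 : {ω | N ω (Ioc a b) ≠ 0} = {ω | N ω (Ioc a b) = 0}ᶜ := rfl
  simp only [Nat.cast_zero, pow_zero, Nat.factorial_zero, Nat.cast_one, div_one, one_mul] at h1
  rw [h4, h3, h1]
  linarith

theorem prob_one_lt_Ioc_le [IsProbabilityMeasure P]
    (h : IsPoissonRandomMeasure N lebesgueTime P) {a b : ℝ≥0}
    (hab : a ≤ b) : P.real {ω | 1 < N ω (Ioc a b)} ≤ ((b : ℝ) - a) ^ 2 := by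
  have h0 : (0 : ℝ) ≤ (b : ℝ) - a := sub_nonneg.2 (NNReal.coe_le_coe.2 hab)
  have hm := fun c => h.measurableSet_eq (measurableSet_Ioc (a := a) (b := b)) c
  have e0 := h.prob_Ioc_eq hab 0
  have e1 := h.prob_Ioc_eq hab 1
  simp only [Nat.cast_zero, pow_zero, Nat.factorial_zero, Nat.cast_one, div_one, one_mul, pow_one,
    Nat.factorial_one] at e0 e1
  have hsub : {ω | 1 < N ω (Ioc a b)}
      ⊆ ({ω | N ω (Ioc a b) = 0} ∪ {ω | N ω (Ioc a b) = 1})ᶜ := by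
    intro ω hω hmem
    rw [mem_ofPred_eq] at hω
    rcases hmem with h' | h' <;> rw [mem_ofPred_eq] at h' <;> simp [h'] at hω
  have hdisj : Disjoint {ω | N ω (Ioc a b) = 0} {ω | N ω (Ioc a b) = 1} := by
    refine Set.disjoint_left.2 fun ω hi hj => ?_
    rw [mem_ofPred_eq] at hi hj
    exact zero_ne_one (hi.symm.trans hj)
  have h2 := Real.one_sub_le_exp_neg ((b : ℝ) - a)
  refine (measureReal_mono hsub).trans ?_
  rw [probReal_compl_eq_one_sub ((hm 0).union (hm 1)), measureReal_union hdisj (hm 1), e0, e1]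
  -- With `x = b - a`, the bound is `1 - (1 + x) e^{-x} ≤ 1 - (1 + x)(1 - x) = x²`.
  nlinarith

end IsPoissonRandomMeasure

namespace IsStandardPoissonFamily

/-- In an interval of length `x`, two points of one process, or a point of each of two independent
processes, occur with probability at most `x²`. The covering argument then excludes double and
shared atoms at all positive times simultaneously. -/
theorem ae_isSimpleFamily {Ω ι : Type*} [MeasurableSpace Ω] [Fintype ι] {P : Measure Ω}
    [IsProbabilityMeasure P] {N : ι → Ω → Measure ℝ≥0} (hN : IsStandardPoissonFamily N P) :
    ∀ᵐ ω ∂P, IsSimpleFamily (fun α => N α ω) := by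
  have h1 : ∀ᵐ ω ∂P, ∀ α t, N α ω (Iic t) < ∞ :=
    ae_all_iff.2 fun α => (hN.poisson α).ae_forall_Iic_lt_top
  have h2 : ∀ᵐ ω ∂P, ∀ α, ∀ s : ℝ≥0, 0 < s → ω ∉ {ω | 1 < N α ω {s}} := by
    refine ae_all_iff.2 fun α => ae_forall_singleton_notMem (fun A => {ω | 1 < N α ω A})
      (fun A B hAB ω hω => lt_of_lt_of_le hω (measure_mono hAB)) fun a b hab => ?_
    rw [← ofReal_measureReal]
    exact ENNReal.ofReal_le_ofReal ((hN.poisson α).prob_one_lt_Ioc_le hab)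
  have h3 : ∀ᵐ ω ∂P, ∀ α β, α ≠ β → ∀ s : ℝ≥0, 0 < s →
      ω ∉ {ω | N α ω {s} ≠ 0} ∩ {ω | N β ω {s} ≠ 0} := by
    refine ae_all_iff.2 fun α => ae_all_iff.2 fun β => ?_
    by_cases hαβ : α = β
    · simp [hαβ]
    have := ae_forall_singleton_notMem (P := P)
      (fun A => {ω | N α ω A ≠ 0} ∩ {ω | N β ω A ≠ 0}) ?_ fun a b hab => ?_
    · filter_upwards [this] with ω hω _ using hω
    · exact fun A B hAB ω hω => ⟨fun h => hω.1 (measure_mono_null hAB h),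
        fun h => hω.2 (measure_mono_null hAB h)⟩
    · have hset : MeasurableSet {m : Measure ℝ≥0 | m (Ioc a b) ≠ 0} :=
        (Measure.measurable_coe measurableSet_Ioc) (measurableSet_singleton 0).compl
      have hind := ((hN.indep.indepFun hαβ).measure_inter_preimage_eq_mul _ _ hset hset)
      have h0 : (0 : ℝ) ≤ (b : ℝ) - a := sub_nonneg.2 (NNReal.coe_le_coe.2 hab)
      have hα := (hN.poisson α).prob_Ioc_ne_zero_le hab
      have hβ := (hN.poisson β).prob_Ioc_ne_zero_le hab
      have hle : P ({ω | N α ω (Ioc a b) ≠ 0} ∩ {ω | N β ω (Ioc a b) ≠ 0})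
          = P {ω | N α ω (Ioc a b) ≠ 0} * P {ω | N β ω (Ioc a b) ≠ 0} := hind
      rw [hle, sq, ENNReal.ofReal_mul h0, ← ofReal_measureReal, ← ofReal_measureReal]
      gcongr
  filter_upwards [h1, h2, h3] with ω h1 h2 h3
  refine ⟨h1, fun α => measure_nonatoms_eq_zero (h1 α) ((hN.poisson α).integer_valued ω),
    fun α s hs h0 => ?_, fun α β s hs hα hβ => ?_⟩
  · have hle : N α ω {s} ≤ 1 := not_lt.1 (h2 α s hs)
    obtain ⟨k, hk⟩ := (hN.poisson α).integer_valued ω {s} (measurableSet_singleton s)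
    simp only [hk] at hle h0 ⊢
    have h4 : k ≤ 1 := by exact_mod_cast hle
    have h5 : k ≠ 0 := by rintro rfl; simp at h0
    have h6 : k = 1 := le_antisymm h4 (Order.one_le_iff_ne_zero.2 h5)
    simp [h6]
  · by_contra hne
    exact h3 α β hne s hs ⟨hα, hβ⟩

end IsStandardPoissonFamily

/-! ### The product formula for measures with atoms. -/

section ProductFormula

variable {𝓗 : Type*} [NormedAddCommGroup 𝓗] [InnerProductSpace ℂ 𝓗]

theorem integrable_re_inner_prod {X : Type*} [MeasurableSpace X] {μ : Measure X}
    [SFinite μ] {G : X → 𝓗} (hG : Integrable G μ) :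
    Integrable (fun p : X × X => (⟪G p.1, G p.2⟫_ℂ).re) (μ.prod μ) := by
  have h : Integrable (fun p : X × X => ⟪G p.1, G p.2⟫_ℂ) (μ.prod μ) := by
    refine (hG.norm.mul_prod hG.norm).mono' ?_ (ae_of_all _ fun p => norm_inner_le_norm _ _)
    exact (hG.aestronglyMeasurable.comp_fst).inner hG.aestronglyMeasurable.comp_snd
  exact h.re

theorem re_inner_integral_left [CompleteSpace 𝓗] {X : Type*} [MeasurableSpace X] {μ : Measure X}
    {G : X → 𝓗} (hG : Integrable G μ) (c : 𝓗) :
    (⟪∫ x, G x ∂μ, c⟫_ℂ).re = ∫ x, (⟪G x, c⟫_ℂ).re ∂μ := by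
  have h1 : (⟪∫ x, G x ∂μ, c⟫_ℂ).re = (⟪c, ∫ x, G x ∂μ⟫_ℂ).re := inner_re_symm (𝕜 := ℂ) _ _
  have h2 : ∀ x, (⟪G x, c⟫_ℂ).re = (⟪c, G x⟫_ℂ).re := fun x => inner_re_symm (𝕜 := ℂ) _ _
  simp_rw [h1, h2, ← integral_inner hG c]
  exact (integral_re (𝕜 := ℂ) (hG.const_inner c)).symm

theorem integral_add_add {X : Type*} [MeasurableSpace X] {μ : Measure X} {f g h : X → ℝ}
    (hf : Integrable f μ) (hg : Integrable g μ) (hh : Integrable h μ) :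
    ∫ x, (f x + g x + h x) ∂μ = ∫ x, f x ∂μ + ∫ x, g x ∂μ + ∫ x, h x ∂μ := by
  rw [← integral_add hf hg]
  exact integral_add (hf.add hg) hh

variable [CompleteSpace 𝓗]

/-- Write the square as a double integral of `Re⟨G r, G s⟩` and split it into `r < s`, `r > s` and
`r = s`. The first two parts agree by symmetry and Fubini; the diagonal is charged only by the atoms
of `μ`. -/
theorem norm_sq_integral_eq {μ : Measure ℝ≥0} [IsFiniteMeasure μ] {G : ℝ≥0 → 𝓗}
    (hG : Integrable G μ) :
    Integrable (fun s => (⟪∫ r in Iio s, G r ∂μ, G s⟫_ℂ).re) μ ∧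
    Integrable (fun s => μ.real {s} * ‖G s‖ ^ 2) μ ∧
    ‖∫ s, G s ∂μ‖ ^ 2 = 2 * (∫ s, (⟪∫ r in Iio s, G r ∂μ, G s⟫_ℂ).re ∂μ)
      + ∫ s, μ.real {s} * ‖G s‖ ^ 2 ∂μ := by
  let k : ℝ≥0 × ℝ≥0 → ℝ := fun p => (⟪G p.1, G p.2⟫_ℂ).re
  have hk : Integrable k (μ.prod μ) := integrable_re_inner_prod hG
  have hksymm : ∀ r s, k (r, s) = k (s, r) := fun r s => inner_re_symm (𝕜 := ℂ) _ _
  have hlt : Integrable ({p : ℝ≥0 × ℝ≥0 | p.1 < p.2}.indicator k) (μ.prod μ) :=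
    hk.indicator (measurableSet_lt measurable_fst measurable_snd)
  have hgt : Integrable ({p : ℝ≥0 × ℝ≥0 | p.2 < p.1}.indicator k) (μ.prod μ) :=
    hk.indicator (measurableSet_lt measurable_snd measurable_fst)
  have heq : Integrable ({p : ℝ≥0 × ℝ≥0 | p.1 = p.2}.indicator k) (μ.prod μ) :=
    hk.indicator (measurableSet_eq_fun measurable_fst measurable_snd)
  have ha : ∀ s, ∫ r, {p : ℝ≥0 × ℝ≥0 | p.1 < p.2}.indicator k (r, s) ∂μ
      = (⟪∫ r in Iio s, G r ∂μ, G s⟫_ℂ).re := fun s => by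
    rw [re_inner_integral_left hG.integrableOn, ← integral_indicator measurableSet_Iio]
    rfl
  have hd : ∀ s, ∫ r, {p : ℝ≥0 × ℝ≥0 | p.1 = p.2}.indicator k (r, s) ∂μ
      = μ.real {s} * ‖G s‖ ^ 2 := fun s => by
    have h1 : ∀ r, {p : ℝ≥0 × ℝ≥0 | p.1 = p.2}.indicator k (r, s)
        = ({s} : Set ℝ≥0).indicator (fun r => k (r, s)) r := fun r => rfl
    simp_rw [h1]
    rw [integral_indicator (measurableSet_singleton s), integral_singleton, smul_eq_mul]
    congr 1
    exact inner_self_eq_norm_sq (𝕜 := ℂ) _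
  have hA := hlt.integral_prod_right
  have hB := hgt.integral_prod_right
  have hD := heq.integral_prod_right
  simp only [ha] at hA
  simp only [hd] at hD
  refine ⟨hA, hD, ?_⟩
  have hswap : ∫ s, ∫ r, {p : ℝ≥0 × ℝ≥0 | p.2 < p.1}.indicator k (r, s) ∂μ ∂μ
      = ∫ s, (⟪∫ r in Iio s, G r ∂μ, G s⟫_ℂ).re ∂μ := by
    rw [integral_integral_swap (f := fun s r => {p : ℝ≥0 × ℝ≥0 | p.2 < p.1}.indicator k (r, s))
      hgt.swap]
    simp_rw [← ha]
    congr 1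
    ext r
    congr 1
    ext s
    by_cases h : s < r <;> simp [indicator, h, hksymm r s]
  have hsum : ∀ᵐ s ∂μ, (⟪∫ r, G r ∂μ, G s⟫_ℂ).re
      = (⟪∫ r in Iio s, G r ∂μ, G s⟫_ℂ).re + μ.real {s} * ‖G s‖ ^ 2
        + ∫ r, {p : ℝ≥0 × ℝ≥0 | p.2 < p.1}.indicator k (r, s) ∂μ := by
    filter_upwards [hlt.prod_left_ae, hgt.prod_left_ae, heq.prod_left_ae] with s h1 h2 h3
    rw [← ha, ← hd, re_inner_integral_left hG, ← integral_add_add h1 h3 h2]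
    congr 1
    ext r
    rcases lt_trichotomy r s with h | h | h
    · simp [indicator, h, h.ne, h.not_gt, k]
    · simp [indicator, h, k]
    · simp [indicator, h, h.ne', h.not_gt, k]
  have h0 : ‖∫ s, G s ∂μ‖ ^ 2 = ∫ s, (⟪∫ r, G r ∂μ, G s⟫_ℂ).re ∂μ := by
    have h1 : (⟪∫ s, G s ∂μ, ∫ s, G s ∂μ⟫_ℂ).re = ‖∫ s, G s ∂μ‖ ^ 2 :=
      inner_self_eq_norm_sq (𝕜 := ℂ) _
    rw [← h1, re_inner_integral_left hG]
    exact integral_congr_ae (ae_of_all _ fun s => inner_re_symm (𝕜 := ℂ) _ _)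
  rw [h0, integral_congr_ae hsum, integral_add_add hA hD hB, hswap]
  ring

/-- The product formula for the squared norm of an indefinite integral against a measure which may
have atoms. -/
theorem norm_sq_add_integral_Ioc {M : Measure ℝ≥0} (hM : ∀ t, M (Iic t) < ∞) {G : ℝ≥0 → 𝓗}
    (v : 𝓗) {t : ℝ≥0} (hG : IntegrableOn G (Ioc 0 t) M) :
    ‖v + ∫ s in Ioc 0 t, G s ∂M‖ ^ 2 = ‖v‖ ^ 2 + ∫ s in Ioc 0 t,
      (2 * (⟪v + ∫ r in Ioo 0 s, G r ∂M, G s⟫_ℂ).re + M.real {s} * ‖G s‖ ^ 2) ∂M := by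
  let μ := M.restrict (Ioc 0 t)
  have : IsFiniteMeasure μ :=
    ⟨by simpa [μ] using (measure_mono Ioc_subset_Iic_self).trans_lt (hM t)⟩
  obtain ⟨hA, hD, h⟩ := norm_sq_integral_eq (μ := μ) hG
  have hv : Integrable (fun s => (⟪v, G s⟫_ℂ).re) μ :=
    Integrable.re (𝕜 := ℂ) (Integrable.const_inner v (μ := μ) hG)
  have hv_int : (⟪v, ∫ s, G s ∂μ⟫_ℂ).re = ∫ s, (⟪v, G s⟫_ℂ).re ∂μ := by
    rw [← integral_inner (μ := μ) hG v]
    exact (integral_re (𝕜 := ℂ) (Integrable.const_inner v (μ := μ) hG)).symm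
  have hcongr : ∫ s, (2 * (⟪v + ∫ r in Ioo 0 s, G r ∂M, G s⟫_ℂ).re + M.real {s} * ‖G s‖ ^ 2) ∂μ
      = ∫ s, (2 * (⟪v, G s⟫_ℂ).re + 2 * (⟪∫ r in Iio s, G r ∂μ, G s⟫_ℂ).re
        + μ.real {s} * ‖G s‖ ^ 2) ∂μ := by
    refine setIntegral_congr_fun measurableSet_Ioc fun s hs => ?_
    have h1 : Iio s ∩ Ioc 0 t = Ioo 0 s := by
      ext r
      simp only [mem_inter_iff, mem_Iio, mem_Ioc, mem_Ioo]
      exact ⟨fun h => ⟨h.2.1, h.1⟩, fun h => ⟨h.2, h.1, h.2.le.trans hs.2⟩⟩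
    have h2 : μ.real {s} = M.real {s} := by
      simp only [μ, measureReal_def, Measure.restrict_apply (measurableSet_singleton s)]
      rw [inter_eq_left.2 (singleton_subset_iff.2 hs)]
    simp only [μ, Measure.restrict_restrict measurableSet_Iio, h1]
    rw [inner_add_left, Complex.add_re, ← h2, mul_add]
  have h3 := norm_add_sq (𝕜 := ℂ) v (∫ s, G s ∂μ)
  rw [h3, hcongr, integral_add_add (hv.const_mul 2) (hA.const_mul 2) hD, integral_const_mul,
    integral_const_mul, h]
  have h4 : RCLike.re ⟪v, ∫ s, G s ∂μ⟫_ℂ = ∫ s, (⟪v, G s⟫_ℂ).re ∂μ := hv_int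
  rw [h4]
  ring

end ProductFormula

/-! ### One-sided limits of indefinite integrals. -/

/-- The limit omits the atom at `s`. This identifies the integral over `(0, s)` in the product
formula with the left limit of the path. -/
theorem tendsto_integral_Ioc_nhdsLT {E : Type*} [NormedAddCommGroup E] [NormedSpace ℝ E]
    {M : Measure ℝ≥0} {G : ℝ≥0 → E} {s : ℝ≥0} (hG : IntegrableOn G (Ioc 0 s) M) :
    Tendsto (fun r => ∫ x in Ioc 0 r, G x ∂M) (𝓝[<] s) (𝓝 (∫ x in Ioo 0 s, G x ∂M)) := by
  simp_rw [← integral_indicator measurableSet_Ioc, ← integral_indicator measurableSet_Ioo]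
  have hGs : Integrable ((Ioc 0 s).indicator G) M := hG.integrable_indicator measurableSet_Ioc
  refine tendsto_integral_filter_of_dominated_convergence
    (fun x => ‖(Ioc 0 s).indicator G x‖) ?_ ?_ hGs.norm ?_
  · filter_upwards [self_mem_nhdsWithin] with r hr
    exact ((hG.mono_set (Ioc_subset_Ioc_right (mem_Iio.1 hr).le)).integrable_indicator
      measurableSet_Ioc).aestronglyMeasurable
  · filter_upwards [self_mem_nhdsWithin] with r hr
    exact ae_of_all _ fun x => norm_indicator_le_of_subset
      (Ioc_subset_Ioc_right (mem_Iio.1 hr).le) _ _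
  · refine ae_of_all _ fun x => tendsto_const_nhds.congr' ?_
    by_cases hx : x < s
    · filter_upwards [Ioo_mem_nhdsLT hx] with r hr
      simp [indicator, hx, hr.1.le]
    · filter_upwards [self_mem_nhdsWithin] with r hr
      have : ¬ x ≤ r := fun h => hx (h.trans_lt hr)
      simp [indicator, hx, this]

theorem tendsto_integral_Ioc_nhdsGT {E : Type*} [NormedAddCommGroup E] [NormedSpace ℝ E]
    {M : Measure ℝ≥0} {G : ℝ≥0 → E} {s b : ℝ≥0} (hsb : s < b) (hG : IntegrableOn G (Ioc s b) M) :
    Tendsto (fun r => ∫ x in Ioc s r, G x ∂M) (𝓝[>] s) (𝓝 0) := by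
  simp_rw [← integral_indicator measurableSet_Ioc]
  rw [← integral_zero ℝ≥0 E (μ := M)]
  have hGs : Integrable ((Ioc s b).indicator G) M := hG.integrable_indicator measurableSet_Ioc
  refine tendsto_integral_filter_of_dominated_convergence
    (fun x => ‖(Ioc s b).indicator G x‖) ?_ ?_ hGs.norm ?_
  · filter_upwards [Ioo_mem_nhdsGT hsb] with r hr
    exact ((hG.mono_set (Ioc_subset_Ioc_right hr.2.le)).integrable_indicator
      measurableSet_Ioc).aestronglyMeasurable
  · filter_upwards [Ioo_mem_nhdsGT hsb] with r hr
    exact ae_of_all _ fun x => norm_indicator_le_of_subset (Ioc_subset_Ioc_right hr.2.le) _ _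
  · refine ae_of_all _ fun x => tendsto_const_nhds.congr' ?_
    by_cases hx : s < x
    · filter_upwards [Ioo_mem_nhdsGT hx] with r hr
      simp [indicator, hr.2.not_ge]
    · exact Eventually.of_forall fun r => by simp [indicator, hx]

/-! ### Jumps and drift as one density. -/

section JumpDensity

variable {ι : Type*}

/-- The positive times at which `m` has an atom. -/
def jumpTimes (m : Measure ℝ≥0) : Set ℝ≥0 := {s | 0 < s ∧ m {s} ≠ 0}

theorem countable_jumpTimes {m : Measure ℝ≥0} (hm : ∀ t, m (Iic t) < ∞) :
    (jumpTimes m).Countable := by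
  have := isLocallyFiniteMeasure_of_Iic hm
  refine (Measure.countable_meas_pos_of_disjoint_iUnion (μ := m)
    (As := fun s : ℝ≥0 => {s}) (fun s => measurableSet_singleton s) ?_).mono
    fun s hs => pos_iff_ne_zero.2 hs.2
  exact fun r s hrs => disjoint_singleton.2 hrs

/-- Lebesgue measure plus the counting measures of a family of point processes. -/
noncomputable def drivingMeasure [Fintype ι] (n : ι → Measure ℝ≥0) : Measure ℝ≥0 :=
  lebesgueTime + ∑ α, n α

/-- The function equal to `f α` at the jump times of `n α`, and to `c` at all other times. -/
noncomputable def jumpDensity [Fintype ι] {E : Type*} [AddCommMonoid E] (n : ι → Measure ℝ≥0)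
    (f : ι → ℝ≥0 → E) (c : ℝ≥0 → E) (s : ℝ≥0) : E :=
  ∑ α, (jumpTimes (n α)).indicator (f α) s + (⋃ α, jumpTimes (n α))ᶜ.indicator c s

theorem jumpDensity_of_notMem [Fintype ι] {E : Type*} [AddCommMonoid E] {n : ι → Measure ℝ≥0}
    (f : ι → ℝ≥0 → E) (c : ℝ≥0 → E) {s : ℝ≥0} (hs : s ∉ ⋃ α, jumpTimes (n α)) :
    jumpDensity n f c s = c s := by
  rw [jumpDensity, indicator_of_mem hs, Finset.sum_eq_zero, zero_add]
  exact fun α _ => indicator_of_notMem (fun h => hs (mem_iUnion_of_mem α h)) _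

theorem IsSimpleFamily.ae_mem_jumpTimes {n : ι → Measure ℝ≥0} (hn : IsSimpleFamily n)
    (α : ι) (t : ℝ≥0) :
    ∀ᵐ s ∂(n α).restrict (Ioc 0 t), s ∈ jumpTimes (n α) := by
  rw [ae_restrict_iff' measurableSet_Ioc]
  have h : ∀ᵐ s ∂n α, n α {s} ≠ 0 := by
    rw [ae_iff]
    simpa using hn.carried α
  filter_upwards [h] with s hs ht using ⟨ht.1, hs⟩

namespace IsSimpleFamily

variable [Fintype ι] {n : ι → Measure ℝ≥0} (hn : IsSimpleFamily n)

include hn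

theorem countable_iUnion_jumpTimes : (⋃ α, jumpTimes (n α)).Countable :=
  countable_iUnion fun α => countable_jumpTimes (hn.finite α)

theorem jumpDensity_of_mem {E : Type*} [AddCommMonoid E] (f : ι → ℝ≥0 → E) (c : ℝ≥0 → E)
    {α : ι} {s : ℝ≥0} (hs : s ∈ jumpTimes (n α)) : jumpDensity n f c s = f α s := by
  rw [jumpDensity, indicator_of_notMem (notMem_compl_iff.2 (mem_iUnion_of_mem α hs)), add_zero,
    Finset.sum_eq_single α, indicator_of_mem hs]
  · exact fun β _ hβ => indicator_of_notMem (fun h => hβ (hn.disjoint β α s hs.1 h.2 hs.2)) _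
  · simp

theorem stronglyMeasurable_jumpDensity {E : Type*} [NormedAddCommGroup E] {f : ι → ℝ≥0 → E}
    {c : ℝ≥0 → E} (hf : ∀ α, StronglyMeasurable (f α)) (hc : StronglyMeasurable c) :
    StronglyMeasurable (jumpDensity n f c) :=
  (Finset.stronglyMeasurable_fun_sum _ fun α _ =>
    (hf α).indicator (countable_jumpTimes (hn.finite α)).measurableSet).add
    (hc.indicator hn.countable_iUnion_jumpTimes.measurableSet.compl)

theorem ae_notMem_jumpTimes : ∀ᵐ s ∂lebesgueTime, s ∉ ⋃ α, jumpTimes (n α) :=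
  measure_eq_zero_iff_ae_notMem.1 (hn.countable_iUnion_jumpTimes.measure_zero _)

theorem drivingMeasure_Iic_lt_top (t : ℝ≥0) : drivingMeasure n (Iic t) < ∞ := by
  rw [drivingMeasure, Measure.add_apply, Measure.finsetSum_apply, lebesgueTime_Iic]
  exact ENNReal.add_lt_top.2 ⟨ENNReal.ofReal_lt_top,
    ENNReal.sum_lt_top.2 fun α _ => hn.finite α t⟩

theorem drivingMeasure_real_singleton_of_mem {α : ι} {s : ℝ≥0} (hs : s ∈ jumpTimes (n α)) :
    (drivingMeasure n).real {s} = 1 := by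
  rw [measureReal_def, drivingMeasure, Measure.add_apply, Measure.finsetSum_apply,
    measure_singleton, zero_add, Finset.sum_eq_single α, hn.unit α s hs.1 hs.2, ENNReal.toReal_one]
  · exact fun β _ hβ => by_contra fun h => hβ (hn.disjoint β α s hs.1 h hs.2)
  · simp

omit hn in
theorem _root_.drivingMeasure_real_singleton_of_notMem {s : ℝ≥0} (h0 : 0 < s)
    (hs : s ∉ ⋃ α, jumpTimes (n α)) : (drivingMeasure n).real {s} = 0 := by
  rw [measureReal_def, drivingMeasure, Measure.add_apply, Measure.finsetSum_apply,
    measure_singleton, zero_add, Finset.sum_eq_zero, ENNReal.toReal_zero]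
  exact fun β _ => by_contra fun h => hs (mem_iUnion_of_mem β ⟨h0, h⟩)

omit hn in
theorem _root_.restrict_drivingMeasure (A : Set ℝ≥0) :
    (drivingMeasure n).restrict A = lebesgueTime.restrict A + ∑ α, (n α).restrict A := by
  rw [drivingMeasure, Measure.restrict_add]
  congr 1
  exact map_sum (Measure.restrictₗ A) n Finset.univ

/-- Splits an almost-everywhere check: `n α` on `(0, t]` is carried by its jump times, and Lebesgue
measure ignores the countable set of all jump times. -/
theorem ae_drivingMeasure {t : ℝ≥0} {p : ℝ≥0 → Prop} (h1 : ∀ α, ∀ s ∈ jumpTimes (n α), s ≤ t → p s)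
    (h2 : ∀ᵐ s ∂lebesgueTime, 0 < s → s ≤ t → s ∉ ⋃ α, jumpTimes (n α) → p s) :
    ∀ᵐ s ∂(drivingMeasure n).restrict (Ioc 0 t), p s := by
  rw [restrict_drivingMeasure, ae_iff, Measure.add_apply, Measure.finsetSum_apply, add_eq_zero,
    Finset.sum_eq_zero_iff]
  simp_rw [← ae_iff]
  constructor
  · rw [ae_restrict_iff' measurableSet_Ioc]
    filter_upwards [h2, hn.ae_notMem_jumpTimes] with s h h' ht using h ht.1 ht.2 h'
  · intro α _
    filter_upwards [hn.ae_mem_jumpTimes α t, ae_restrict_mem measurableSet_Ioc] with s hs ht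
    exact h1 α s hs ht.2

variable {E : Type*} [NormedAddCommGroup E] {f : ι → ℝ≥0 → E} {c : ℝ≥0 → E} {t : ℝ≥0}

theorem jumpDensity_ae_eq_jump (α : ι) (t : ℝ≥0) :
    jumpDensity n f c =ᵐ[(n α).restrict (Ioc 0 t)] f α := by
  filter_upwards [hn.ae_mem_jumpTimes α t] with s hs using hn.jumpDensity_of_mem f c hs

theorem jumpDensity_ae_eq_drift (t : ℝ≥0) :
    jumpDensity n f c =ᵐ[lebesgueTime.restrict (Ioc 0 t)] c := by
  filter_upwards [ae_restrict_of_ae hn.ae_notMem_jumpTimes] with s hs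
    using jumpDensity_of_notMem f c hs

theorem integrableOn_jumpDensity (hf : ∀ α, IntegrableOn (f α) (Ioc 0 t) (n α))
    (hc : IntegrableOn c (Ioc 0 t) lebesgueTime) :
    IntegrableOn (jumpDensity n f c) (Ioc 0 t) (drivingMeasure n) := by
  rw [IntegrableOn, restrict_drivingMeasure, integrable_add_measure, integrable_finsetSum_measure]
  exact ⟨hc.congr (hn.jumpDensity_ae_eq_drift t).symm,
    fun α _ => (hf α).congr (hn.jumpDensity_ae_eq_jump α t).symm⟩

theorem integral_jumpDensity [NormedSpace ℝ E] (hf : ∀ α, IntegrableOn (f α) (Ioc 0 t) (n α))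
    (hc : IntegrableOn c (Ioc 0 t) lebesgueTime) :
    ∫ s in Ioc 0 t, jumpDensity n f c s ∂drivingMeasure n
      = ∑ α, (∫ s in Ioc 0 t, f α s ∂n α) + ∫ s in Ioc 0 t, c s ∂lebesgueTime := by
  have hi := hn.integrableOn_jumpDensity hf hc
  rw [IntegrableOn, restrict_drivingMeasure, integrable_add_measure] at hi
  rw [restrict_drivingMeasure, integral_add_measure hi.1 hi.2,
    integral_finsetSum_measure (integrable_finsetSum_measure.1 hi.2), add_comm]
  congr 1
  · exact Finset.sum_congr rfl fun α _ => integral_congr_ae (hn.jumpDensity_ae_eq_jump α t)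
  · exact integral_congr_ae (hn.jumpDensity_ae_eq_drift t)

/-- A sum of compensated integrals is one integral against the driving measure. -/
theorem sum_compIntegral_eq [NormedSpace ℝ E] (hf : ∀ α, CompIntegrable (n α) (f α) t) :
    ∑ α, compIntegral (n α) (f α) t
      = ∫ s in Ioc 0 t, jumpDensity n f (fun s => -∑ α, f α s) s ∂drivingMeasure n := by
  have hc : IntegrableOn (fun s => -∑ α, f α s) (Ioc 0 t) lebesgueTime :=
    (integrable_finsetSum _ fun α _ => (hf α).2).neg
  rw [hn.integral_jumpDensity (fun α => (hf α).1) hc, integral_neg,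
    integral_finsetSum _ fun α _ => (hf α).2]
  simp only [compIntegral, Finset.sum_sub_distrib]
  abel

end IsSimpleFamily

end JumpDensity

/-! ### Pathwise Stieltjes integrals. -/

section Stieltjes

/-- Two representations satisfy `μ + ν' = μ' + ν` on half-open subintervals of `(0, t]`. These are
positive finite measures, so they coincide there, and integrating `f` gives the claim. -/
theorem IsStieltjesIntegral.unique {f x : ℝ≥0 → ℝ} {t : ℝ≥0} {I J : ℝ}
    (hI : IsStieltjesIntegral f x t I) (hJ : IsStieltjesIntegral f x t J) : I = J := by
  obtain ⟨μ, ν, _, _, h, hμ, hν, rfl⟩ := hI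
  obtain ⟨μ', ν', _, _, h', hμ', hν', rfl⟩ := hJ
  have key : μ.restrict (Ioc 0 t) + ν'.restrict (Ioc 0 t)
      = μ'.restrict (Ioc 0 t) + ν.restrict (Ioc 0 t) := by
    have hsub : ∀ a b, a ≤ b → b ≤ t → μ (Ioc a b) + ν' (Ioc a b) = μ' (Ioc a b) + ν (Ioc a b) := by
      intro a b hab hbt
      have h1 := h a b hab hbt
      have h2 := h' a b hab hbt
      rw [← ENNReal.toReal_eq_toReal_iff' (by finiteness) (by finiteness),
        ENNReal.toReal_add (by finiteness) (by finiteness),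
        ENNReal.toReal_add (by finiteness) (by finiteness)]
      simp only [measureReal_def] at h1 h2
      linarith
    refine Measure.ext_of_Ioc_finite _ _ ?_ fun a b hab => ?_
    · simpa using hsub 0 t zero_le le_rfl
    · simp only [Measure.add_apply, Measure.restrict_apply measurableSet_Ioc, Ioc_inter_Ioc]
      rcases le_total (max a 0) (min b t) with hle | hle
      · exact hsub _ _ hle (min_le_right _ _)
      · simp only [Ioc_eq_empty_of_le hle, measure_empty]
  have : ∫ s, f s ∂_ = ∫ s, f s ∂_ := congrArg (fun m => ∫ s, f s ∂m) key
  rw [integral_add_measure hμ hν', integral_add_measure hμ' hν] at this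
  linarith

/-- Integrating against the indefinite integral of `g` is integrating against `g`. -/
theorem isStieltjesIntegral_of_density {M : Measure ℝ≥0} {f g x : ℝ≥0 → ℝ} {t : ℝ≥0} (hg : StronglyMeasurable g) (hgi : IntegrableOn g (Ioc 0 t) M)
    (hx : ∀ s ≤ t, x s = ∫ r in Ioc 0 s, g r ∂M) (hf : StronglyMeasurable f)
    (hfb : ∃ C, 0 ≤ C ∧ ∀ s ≤ t, ‖f s‖ ≤ C) :
    IsStieltjesIntegral f x t (∫ s in Ioc 0 t, f s * g s ∂M) := by
  let m := M.restrict (Ioc 0 t)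
  -- The representing measures have the positive and negative parts of `g` as densities.
  let μ := m.withDensity fun s => ENNReal.ofReal (g s)
  let ν := m.withDensity fun s => ENNReal.ofReal (-g s)
  have hgm : Integrable g m := hgi
  have hfinμ : IsFiniteMeasure μ := isFiniteMeasure_withDensity_ofReal hgm.2
  have hfinν : IsFiniteMeasure ν := isFiniteMeasure_withDensity_ofReal hgm.neg.2
  have hmg := hg.measurable
  have hmn : Measurable fun s => -g s := hmg.neg
  have hint : ∀ h : ℝ≥0 → ℝ, ∀ A, MeasurableSet A → IntegrableOn (fun s => h s * g s) A m →
      StronglyMeasurable h → (∫ s in A, h s ∂μ) - ∫ s in A, h s ∂ν = ∫ s in A, h s * g s ∂m := by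
    intro h A hA hhg hh
    rw [setIntegral_withDensity_eq_setIntegral_toReal_smul hmg.ennreal_ofReal
        (ae_of_all _ fun _ => ENNReal.ofReal_lt_top) _ hA,
      setIntegral_withDensity_eq_setIntegral_toReal_smul hmn.ennreal_ofReal
        (ae_of_all _ fun _ => ENNReal.ofReal_lt_top) _ hA, ← integral_sub]
    · refine integral_congr_ae (ae_of_all _ fun s => ?_)
      simp only [ENNReal.toReal_ofReal', smul_eq_mul]
      rw [← sub_mul, mul_comm]
      congr 1
      rcases le_total 0 (g s) with h0 | h0 <;> simp [h0]
    · refine Integrable.mono hhg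
        (hmg.ennreal_ofReal.ennreal_toReal.stronglyMeasurable.smul hh).aestronglyMeasurable
        (ae_of_all _ fun s => ?_)
      simp only [ENNReal.toReal_ofReal', smul_eq_mul, norm_mul, Real.norm_eq_abs]
      rw [mul_comm]
      refine mul_le_mul_of_nonneg_left ?_ (abs_nonneg _)
      rw [abs_of_nonneg (le_max_right _ _)]
      exact max_le (le_abs_self _) (abs_nonneg _)
    · refine Integrable.mono hhg
        (hmn.ennreal_ofReal.ennreal_toReal.stronglyMeasurable.smul hh).aestronglyMeasurable
        (ae_of_all _ fun s => ?_)
      simp only [ENNReal.toReal_ofReal', smul_eq_mul, norm_mul, Real.norm_eq_abs]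
      rw [mul_comm]
      refine mul_le_mul_of_nonneg_left ?_ (abs_nonneg _)
      rw [abs_of_nonneg (le_max_right _ _)]
      exact max_le (neg_le_abs _) (abs_nonneg _)
  obtain ⟨C, hC0, hC⟩ := hfb
  have hfg : IntegrableOn (fun s => f s * g s) (Ioc 0 t) m := by
    rw [IntegrableOn, Measure.restrict_restrict measurableSet_Ioc, inter_self]
    refine Integrable.bdd_mul hgm hf.aestronglyMeasurable (c := C) ?_
    filter_upwards [ae_restrict_mem measurableSet_Ioc] with s hs using hC s hs.2
  have hbound : ∀ m' : Measure ℝ≥0, IsFiniteMeasure m' → IntegrableOn f (Ioc 0 t) m' :=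
    fun m' _ => Integrable.of_bound hf.aestronglyMeasurable C (by
      filter_upwards [ae_restrict_mem measurableSet_Ioc] with s hs using hC s hs.2)
  refine ⟨μ, ν, hfinμ, hfinν, fun a b hab hbt => ?_, hbound μ hfinμ, hbound ν hfinν, ?_⟩
  · have h1 := hint (fun _ => 1) (Ioc a b) measurableSet_Ioc
      (by simpa using hgm.integrableOn) stronglyMeasurable_const
    have hsub : Ioc a b ∩ Ioc 0 t = Ioc a b := inter_eq_left.2 (Ioc_subset_Ioc zero_le hbt)
    simp only [integral_const, smul_eq_mul, mul_one, one_mul, measureReal_restrict_apply_univ,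
      m, Measure.restrict_restrict measurableSet_Ioc, hsub] at h1
    rw [h1, hx b hbt, hx a (hab.trans hbt), ← Ioc_union_Ioc_eq_Ioc zero_le hab,
      setIntegral_union (Ioc_disjoint_Ioc_of_le le_rfl) measurableSet_Ioc]
    · ring
    · exact hgi.mono_set (Ioc_subset_Ioc_right (hab.trans hbt))
    · exact hgi.mono_set (Ioc_subset_Ioc zero_le hbt)
  · rw [hint f _ measurableSet_Ioc hfg hf]
    simp only [m, Measure.restrict_restrict measurableSet_Ioc, inter_self]

end Stieltjes

/-! ### Uniqueness for the exponential equation. -/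

section Uniqueness

/-- A linear homogeneous integral equation has no nonzero càdlàg solution. -/
theorem IsCadlag.eq_zero_of_integral_eq {M : Measure ℝ≥0} {g w : ℝ≥0 → ℝ} (hw : IsCadlag w)
    (hg : ∀ t, IntegrableOn g (Ioc 0 t) M)
    (h : ∀ t, w t = ∫ s in Ioc 0 t, Function.leftLim w s * g s ∂M) : w = 0 := by
  by_contra hne
  obtain ⟨t₀, ht₀⟩ : ∃ t, w t ≠ 0 := by
    by_contra! h'
    exact hne (funext h')
  -- `τ` will be the last time up to which `w` vanishes; the aim is to push the vanishing past it.
  let Z : Set ℝ≥0 := {t | ∀ s ≤ t, w s = 0}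
  have h0 : (0 : ℝ≥0) ∈ Z := fun s hs => by
    rw [nonpos_iff_eq_zero.1 hs, h 0]
    simp
  have hbdd : BddAbove Z := ⟨t₀, fun t ht => not_lt.1 fun hlt => ht₀ (ht t₀ hlt.le)⟩
  set τ := sSup Z with hτ
  have hlt : ∀ s < τ, w s = 0 := fun s hs => by
    obtain ⟨z, hz, hsz⟩ := exists_lt_of_lt_csSup ⟨0, h0⟩ hs
    exact hz s hsz.le
  have hleft : ∀ s, 0 < s → s ≤ τ → Function.leftLim w s = 0 := fun s hs hsτ =>
    norm_le_zero_iff.1 (hw.norm_leftLim_le hs fun r _ hr => by simp [hlt r (hr.trans_le hsτ)])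
  -- Vanishing extends to `τ` itself even if `M` has an atom there, since the integrand involves
  -- only left limits.
  have hle : ∀ s ≤ τ, w s = 0 := fun s hs => by
    rw [h s]
    refine setIntegral_eq_zero_of_forall_eq_zero fun r hr => ?_
    rw [hleft r hr.1 (hr.2.trans hs), zero_mul]
  have hlim := tendsto_integral_Ioc_nhdsGT (lt_add_one τ)
    ((hg (τ + 1)).mono_set (Ioc_subset_Ioc_left zero_le)).norm
  obtain ⟨r, hr, hτr⟩ : ∃ r, (∫ s in Ioc τ r, ‖g s‖ ∂M) ≤ 1 / 2 ∧ τ < r :=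
    ((hlim.eventually (ge_mem_nhds one_half_pos)).and self_mem_nhdsWithin).exists
  have hgr : IntegrableOn (fun s => ‖g s‖) (Ioc τ r) M :=
    ((hg r).mono_set (Ioc_subset_Ioc_left zero_le)).norm
  -- As `∫ |g| dM ≤ 1/2` over `(τ, r]` and `w` is zero up to `τ`, a bound on `[0, r]` can be halved.
  -- Iterating forces `w = 0` on `[0, r]`.
  have step : ∀ C, 0 ≤ C → (∀ s ≤ r, ‖w s‖ ≤ C) → ∀ s ≤ r, ‖w s‖ ≤ C * (1 / 2) := by
    intro C hC0 hC s hs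
    rw [h s]
    have hb : ‖∫ x in Ioc 0 s, Function.leftLim w x * g x ∂M‖
        ≤ ∫ x in Ioc 0 s, (Ioc τ r).indicator (fun x => C * ‖g x‖) x ∂M := by
      refine norm_integral_le_of_norm_le
        ((IntegrableOn.integrable_indicator (hgr.const_mul C) measurableSet_Ioc).integrableOn) ?_
      filter_upwards [ae_restrict_mem measurableSet_Ioc] with x hx
      by_cases hxτ : x ≤ τ
      · rw [hleft x hx.1 hxτ, zero_mul, norm_zero]
        exact indicator_nonneg (fun y _ => by positivity) x
      · rw [indicator_of_mem (show x ∈ Ioc τ r from ⟨not_le.1 hxτ, hx.2.trans hs⟩),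
          norm_mul]
        gcongr
        exact hw.norm_leftLim_le hx.1 fun y _ hy => hC y (hy.le.trans (hx.2.trans hs))
    refine hb.trans ?_
    calc ∫ x in Ioc 0 s, (Ioc τ r).indicator (fun x => C * ‖g x‖) x ∂M
        ≤ ∫ x, (Ioc τ r).indicator (fun x => C * ‖g x‖) x ∂M :=
          setIntegral_le_integral
            (IntegrableOn.integrable_indicator (hgr.const_mul C) measurableSet_Ioc)
            (ae_of_all _ fun x => indicator_nonneg (fun y _ => by positivity) x)
      _ = C * ∫ x in Ioc τ r, ‖g x‖ ∂M := by
          rw [integral_indicator measurableSet_Ioc, integral_const_mul]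
      _ ≤ C * (1 / 2) := by gcongr
  obtain ⟨C, hC0, hC⟩ := hw.exists_norm_le r
  have hpow : ∀ k : ℕ, ∀ s ≤ r, ‖w s‖ ≤ C * (1 / 2) ^ k := by
    intro k
    induction k with
    | zero => simpa using hC
    | succ k ih =>
      intro s hs
      rw [pow_succ, ← mul_assoc]
      exact step _ (by positivity) ih s hs
  have hr_mem : r ∈ Z := fun s hs => by
    have hlim : Tendsto (fun k : ℕ => C * (1 / 2 : ℝ) ^ k) atTop (𝓝 (C * 0)) :=
      (tendsto_pow_atTop_nhds_zero_of_lt_one (by norm_num) (by norm_num)).const_mul C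
    rw [mul_zero] at hlim
    exact norm_le_zero_iff.1 (ge_of_tendsto' hlim fun k => hpow k s hs)
  exact (le_csSup hbdd hr_mem).not_gt hτr

/-- A càdlàg path solving `z t = 1 + ∫_{(0,t]} z_{s-} g s dM` is the Doléans-Dade exponential of
the indefinite integral of `g`. -/
theorem isDoleansDade_of_density {M : Measure ℝ≥0} {g x z : ℝ≥0 → ℝ} (hg : StronglyMeasurable g) (hgi : ∀ t, IntegrableOn g (Ioc 0 t) M)
    (hx : ∀ t, x t = ∫ s in Ioc 0 t, g s ∂M) (hz : IsCadlag z)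
    (hzeq : ∀ t, z t = 1 + ∫ s in Ioc 0 t, Function.leftLim z s * g s ∂M) :
    IsDoleansDade x z := by
  have hst : ∀ y : ℝ≥0 → ℝ, IsCadlag y → ∀ t, IsStieltjesIntegral (Function.leftLim y) x t
      (∫ s in Ioc 0 t, Function.leftLim y s * g s ∂M) := fun y hy t =>
    isStieltjesIntegral_of_density hg (hgi t) (fun s _ => hx s) hy.stronglyMeasurable_leftLim
      (hy.exists_norm_leftLim_le t)
  have hint : ∀ y : ℝ≥0 → ℝ, IsCadlag y → ∀ t,
      IntegrableOn (fun s => Function.leftLim y s * g s) (Ioc 0 t) M := fun y hy t => by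
    obtain ⟨C, -, hC⟩ := hy.exists_norm_leftLim_le t
    refine Integrable.bdd_mul (hgi t) hy.stronglyMeasurable_leftLim.aestronglyMeasurable (c := C) ?_
    filter_upwards [ae_restrict_mem measurableSet_Ioc] with s hs using hC s hs.2
  refine ⟨⟨hz, by simp [hzeq 0], fun t => ?_⟩, fun z' hz' => ?_⟩
  · rw [hzeq t, add_sub_cancel_left]
    exact hst z hz t
  · have hw : IsCadlag fun t => z' t - z t :=
      ⟨fun t => (hz'.cadlag.right_continuous t).sub (hz.right_continuous t),
        fun t => ⟨_, (hz'.cadlag.tendsto_leftLim t).sub (hz.tendsto_leftLim t)⟩⟩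
    have hleft : ∀ t, 0 < t → Function.leftLim (fun t => z' t - z t) t
        = Function.leftLim z' t - Function.leftLim z t := fun t ht => by
      have := nhdsLT_neBot_of_pos ht
      exact leftLim_eq_of_tendsto ((hz'.cadlag.tendsto_leftLim t).sub (hz.tendsto_leftLim t))
    -- Each Stieltjes integral equals the one with density `g`, whatever representation it came
    -- with, so the difference solves the homogeneous equation.
    have h0 := hw.eq_zero_of_integral_eq hgi fun t => by
      have h1 := (hz'.eq t).unique (hst z' hz'.cadlag t)
      have h2 : ∫ s in Ioc 0 t, Function.leftLim (fun t => z' t - z t) s * g s ∂M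
          = ∫ s in Ioc 0 t, (Function.leftLim z' s * g s - Function.leftLim z s * g s) ∂M :=
        setIntegral_congr_fun measurableSet_Ioc fun s hs => by
          simp only [hleft s hs.1, sub_mul]
      rw [h2, integral_sub (hint z' hz'.cadlag t) (hint z hz t), ← h1, hzeq t]
      ring
    funext t
    exact sub_eq_zero.1 (congrFun h0 t)

end Uniqueness

/-! ### The squared norm along a solution. -/

section Unravelling

variable {𝓗 ι : Type*} [NormedAddCommGroup 𝓗] [InnerProductSpace ℂ 𝓗]

theorem re_inner_self_eq (v : 𝓗) : (⟪v, v⟫_ℂ).re = ‖v‖ ^ 2 := inner_self_eq_norm_sq (𝕜 := ℂ) v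

theorem isCadlag_normSqPath {u : ℝ≥0 → 𝓗} (hu : IsCadlag u) : IsCadlag (normSqPath u) :=
  hu.comp (f := fun v : 𝓗 => (⟪v, v⟫_ℂ).re) (by fun_prop)

theorem leftLim_normSqPath {u : ℝ≥0 → 𝓗} (hu : IsCadlag u) (t : ℝ≥0) :
    Function.leftLim (normSqPath u) t = ‖Function.leftLim u t‖ ^ 2 :=
  (hu.leftLim_comp (f := fun v : 𝓗 => (⟪v, v⟫_ℂ).re) (by fun_prop) t).trans (re_inner_self_eq _)

variable [CompleteSpace 𝓗]

/-- Symmetry of `H` makes `⟨v, H v⟩` real; multiplied by `i` it is purely imaginary. -/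
theorem re_inner_I_smul_eq_zero {H : 𝓗 →ₗ.[ℂ] 𝓗} (hH : IsSelfAdjoint H) {v w : 𝓗}
    (hvw : (v, w) ∈ H.graph) : (⟪v, Complex.I • w⟫_ℂ).re = 0 := by
  obtain ⟨x, rfl, rfl⟩ := (LinearPMap.mem_graph_iff H).1 hvw
  have hadj : H.IsFormalAdjoint H := by
    have := LinearPMap.adjoint_isFormalAdjoint hH.dense_domain
    rwa [LinearPMap.isSelfAdjoint_def.1 hH] at this
  have h1 : ⟪(x : 𝓗), H x⟫_ℂ = starRingEnd ℂ ⟪(x : 𝓗), H x⟫_ℂ := by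
    rw [inner_conj_symm, hadj x x]
  have h2 : (⟪(x : 𝓗), H x⟫_ℂ).im = 0 := Complex.conj_eq_iff_im.1 h1.symm
  rw [inner_smul_right, Complex.mul_re, h2]
  simp

theorem re_inner_jump_operator (L : 𝓗 →L[ℂ] 𝓗) (v : 𝓗) :
    (⟪v, (L + ContinuousLinearMap.adjoint L + ContinuousLinearMap.adjoint L ∘L L) v⟫_ℂ).re
      = 2 * (⟪v, L v⟫_ℂ).re + ‖L v‖ ^ 2 := by
  have h1 : (⟪v, ContinuousLinearMap.adjoint L v⟫_ℂ).re = (⟪v, L v⟫_ℂ).re := by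
    rw [ContinuousLinearMap.adjoint_inner_right]
    exact inner_re_symm (𝕜 := ℂ) _ _
  have h2 : (⟪v, ContinuousLinearMap.adjoint L (L v)⟫_ℂ).re = ‖L v‖ ^ 2 := by
    rw [ContinuousLinearMap.adjoint_inner_right]
    exact inner_self_eq_norm_sq (𝕜 := ℂ) _
  simp only [add_apply, ContinuousLinearMap.comp_apply, inner_add_right,
    Complex.add_re, h1, h2]
  ring

/-- At `v = 0` both sides vanish, so a path that hits zero needs no separate treatment. -/
theorem jumpRate_mul_norm_sq (L : 𝓗 →L[ℂ] 𝓗) (v : 𝓗) :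
    jumpRate L v * ‖v‖ ^ 2 = 2 * (⟪v, L v⟫_ℂ).re + ‖L v‖ ^ 2 := by
  rw [jumpRate, re_inner_jump_operator, re_inner_self_eq]
  by_cases hv : v = 0
  · simp [hv]
  · have : ‖v‖ ^ 2 ≠ 0 := by simpa using hv
    field_simp

/-- Uniformity in `v` is what keeps the rate integrable even along paths that approach zero. -/
theorem abs_jumpRate_le (L : 𝓗 →L[ℂ] 𝓗) (v : 𝓗) : |jumpRate L v| ≤ 2 * ‖L‖ + ‖L‖ ^ 2 := by
  by_cases hv : v = 0
  · simp only [jumpRate, hv, inner_zero_left, Complex.zero_re, div_zero, abs_zero]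
    positivity
  have hpos : 0 < ‖v‖ ^ 2 := by positivity
  refine le_of_mul_le_mul_right ?_ hpos
  rw [← abs_of_pos hpos, ← abs_mul, abs_of_pos hpos, jumpRate_mul_norm_sq]
  have h1 : ‖L v‖ ≤ ‖L‖ * ‖v‖ := L.le_opNorm v
  have h2 : |(⟪v, L v⟫_ℂ).re| ≤ ‖v‖ * ‖L v‖ :=
    (Complex.abs_re_le_norm _).trans (norm_inner_le_norm _ _)
  calc |2 * (⟪v, L v⟫_ℂ).re + ‖L v‖ ^ 2|
      ≤ 2 * |(⟪v, L v⟫_ℂ).re| + ‖L v‖ ^ 2 := by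
        refine (abs_add_le _ _).trans_eq ?_
        rw [abs_mul, abs_two, abs_of_nonneg (sq_nonneg ‖L v‖)]
    _ ≤ 2 * (‖v‖ * (‖L‖ * ‖v‖)) + (‖L‖ * ‖v‖) ^ 2 := by
        gcongr
        exact h2.trans (by gcongr)
    _ = (2 * ‖L‖ + ‖L‖ ^ 2) * ‖v‖ ^ 2 := by ring

theorem stronglyMeasurable_ratePath (L : 𝓗 →L[ℂ] 𝓗) {u : ℝ≥0 → 𝓗} (hu : IsCadlag u) :
    StronglyMeasurable (ratePath L u) := by
  have h := hu.stronglyMeasurable_leftLim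
  have h1 : Continuous fun v : 𝓗 =>
      (⟪v, (L + ContinuousLinearMap.adjoint L + ContinuousLinearMap.adjoint L ∘L L) v⟫_ℂ).re := by
    fun_prop
  have h2 : Continuous fun v : 𝓗 => (⟪v, v⟫_ℂ).re := by fun_prop
  exact ((h1.comp_stronglyMeasurable h).measurable.div
    (h2.comp_stronglyMeasurable h).measurable).stronglyMeasurable

theorem compIntegrable_of_bounded {E : Type*} [NormedAddCommGroup E] {n : Measure ℝ≥0}
    (hn : ∀ t, n (Iic t) < ∞) {f : ℝ≥0 → E} (hf : StronglyMeasurable f) {t : ℝ≥0}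
    (hb : ∃ C, 0 ≤ C ∧ ∀ s ≤ t, ‖f s‖ ≤ C) : CompIntegrable n f t :=
  ⟨integrableOn_Ioc_of_bounded hn hf hb,
    integrableOn_Ioc_of_bounded (fun t => by simp [lebesgueTime_Iic]) hf hb⟩

theorem compIntegrable_ratePath (L : 𝓗 →L[ℂ] 𝓗) {u : ℝ≥0 → 𝓗} (hu : IsCadlag u)
    {n : Measure ℝ≥0} (hn : ∀ t, n (Iic t) < ∞) (t : ℝ≥0) :
    CompIntegrable n (ratePath L u) t :=
  compIntegrable_of_bounded hn (stronglyMeasurable_ratePath L hu)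
    ⟨_, by positivity, fun s _ => abs_jumpRate_le L (Function.leftLim u s)⟩

theorem compIntegrable_ratePath_mul (L : 𝓗 →L[ℂ] 𝓗) {u : ℝ≥0 → 𝓗} (hu : IsCadlag u)
    {n : Measure ℝ≥0} (hn : ∀ t, n (Iic t) < ∞) (t : ℝ≥0) :
    CompIntegrable n (fun s => ratePath L u s * Function.leftLim (normSqPath u) s) t := by
  have hc := isCadlag_normSqPath hu
  obtain ⟨C, hC0, hC⟩ := hc.exists_norm_leftLim_le t
  refine compIntegrable_of_bounded hn
    ((stronglyMeasurable_ratePath L hu).mul hc.stronglyMeasurable_leftLim)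
    ⟨(2 * ‖L‖ + ‖L‖ ^ 2) * C, by positivity, fun s hs => ?_⟩
  rw [Pi.mul_apply, norm_mul]
  gcongr
  · exact abs_jumpRate_le L (Function.leftLim u s)
  · exact hC s hs

variable [Fintype ι] {H : 𝓗 →ₗ.[ℂ] 𝓗} {L : ι → 𝓗 →L[ℂ] 𝓗} {φ₀ : 𝓗} {n : ι → Measure ℝ≥0}
  {u : ℝ≥0 → 𝓗}

/-- The squared norm of a solution, with the jumps and the drift written as one density against
the driving measure. -/
theorem SolvesUnravelling.normSqPath_eq_integral (hH : IsSelfAdjoint H) (hn : IsSimpleFamily n)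
    (hu : SolvesUnravelling H L φ₀ n u) (t : ℝ≥0) :
    normSqPath u t = ‖φ₀‖ ^ 2 + ∫ s in Ioc 0 t,
      jumpDensity n (fun α s => ratePath (L α) u s * Function.leftLim (normSqPath u) s)
        (fun s => -∑ α, ratePath (L α) u s * Function.leftLim (normSqPath u) s) s
        ∂drivingMeasure n := by
  obtain ⟨hc, h, hgraph, heq⟩ := hu
  let f : ι → ℝ≥0 → 𝓗 := fun α s => L α (Function.leftLim u s)
  let d : ℝ≥0 → 𝓗 := fun s => Complex.I • h s
    + (1 / 2 : ℂ) • ∑ α, (ContinuousLinearMap.adjoint (L α)) (L α (u s))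
  let G := jumpDensity n f (fun s => -∑ α, f α s - d s)
  have hf : ∀ α t, CompIntegrable (n α) (f α) t := fun α t => by
    obtain ⟨C, hC0, hC⟩ := hc.exists_norm_leftLim_le t
    exact compIntegrable_of_bounded (hn.finite α)
      ((L α).continuous.comp_stronglyMeasurable hc.stronglyMeasurable_leftLim)
      ⟨‖L α‖ * C, by positivity, fun s hs => (L α).le_opNorm_of_le (hC s hs)⟩
  have hd : ∀ t, IntegrableOn d (Ioc 0 t) lebesgueTime := fun t => by
    refine Integrable.add ((heq t).1.smul Complex.I) (Integrable.smul _ ?_)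
    refine integrable_finsetSum _ fun α _ => ?_
    obtain ⟨C, hC0, hC⟩ := hc.exists_norm_le t
    exact integrableOn_Ioc_of_bounded (fun t => by simp [lebesgueTime_Iic])
      ((ContinuousLinearMap.adjoint (L α) ∘L L α).continuous.comp_stronglyMeasurable
        hc.stronglyMeasurable)
      ⟨‖ContinuousLinearMap.adjoint (L α) ∘L L α‖ * C, by positivity,
        fun s hs => (ContinuousLinearMap.adjoint (L α) ∘L L α).le_opNorm_of_le (hC s hs)⟩
  have hsum : ∀ t, IntegrableOn (fun s => ∑ α, f α s) (Ioc 0 t) lebesgueTime := fun t =>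
    integrable_finsetSum _ fun α _ => (hf α t).2
  have hdrift : ∀ t, IntegrableOn (fun s => -∑ α, f α s - d s) (Ioc 0 t) lebesgueTime := fun t =>
    (hsum t).neg.sub (hd t)
  have hG : ∀ t, IntegrableOn G (Ioc 0 t) (drivingMeasure n) := fun t =>
    hn.integrableOn_jumpDensity (fun α => (hf α t).1) (hdrift t)
  have hueq : ∀ t, u t = φ₀ + ∫ s in Ioc 0 t, G s ∂drivingMeasure n := fun t => by
    have h1 : ∫ s in Ioc 0 t, (-∑ α, f α s - d s) ∂lebesgueTime
        = -∑ α, (∫ s in Ioc 0 t, f α s ∂lebesgueTime) - ∫ s in Ioc 0 t, d s ∂lebesgueTime := by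
      rw [← integral_finsetSum _ fun α _ => (hf α t).2, ← integral_neg]
      exact integral_sub (hsum t).neg (hd t)
    rw [(heq t).2, hn.integral_jumpDensity (fun α => (hf α t).1) (hdrift t), h1]
    simp only [compIntegral, Finset.sum_sub_distrib, f, d]
    abel
  have hleft : ∀ s, 0 < s → Function.leftLim u s = φ₀ + ∫ r in Ioo 0 s, G r ∂drivingMeasure n :=
    fun s hs => by
      have := nhdsLT_neBot_of_pos hs
      refine leftLim_eq_of_tendsto ?_
      rw [show u = fun t => φ₀ + ∫ s in Ioc 0 t, G s ∂drivingMeasure n from funext hueq]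
      exact (tendsto_integral_Ioc_nhdsLT (hG s)).const_add φ₀
  -- The drift involves `u s` but the compensator and the product formula involve `u_{s-}`; off the
  -- jump times the two agree.
  have hcont : ∀ s, 0 < s → s ∉ ⋃ α, jumpTimes (n α) → u s = Function.leftLim u s :=
    fun s hs hns => by
      rw [hueq s, hleft s hs, ← Ioo_union_right hs, setIntegral_union (by simp)
        (measurableSet_singleton s) ((hG s).mono_set Ioo_subset_Ioc_self)
        ((hG s).mono_set (singleton_subset_iff.2 ⟨hs, le_rfl⟩)), integral_singleton,
        drivingMeasure_real_singleton_of_notMem hs hns, zero_smul, add_zero]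
  have hrate : ∀ α s, ratePath (L α) u s * Function.leftLim (normSqPath u) s
      = 2 * (⟪Function.leftLim u s, f α s⟫_ℂ).re + ‖f α s‖ ^ 2 := fun α s => by
    rw [leftLim_normSqPath hc]
    exact jumpRate_mul_norm_sq _ _
  rw [normSqPath, re_inner_self_eq, hueq t,
    norm_sq_add_integral_Ioc hn.drivingMeasure_Iic_lt_top φ₀ (hG t)]
  congr 1
  refine integral_congr_ae (hn.ae_drivingMeasure (fun α s hs _ => ?_) ?_)
  -- At a jump the atom has mass one and supplies the quadratic term `‖L α u_-‖²`.
  · beta_reduce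
    rw [hn.jumpDensity_of_mem _ _ hs, hrate, ← hleft s hs.1,
      hn.drivingMeasure_real_singleton_of_mem hs, one_mul]
    simp only [G, hn.jumpDensity_of_mem _ _ hs]
  -- Off the jumps the term `‖L α u‖²` comes instead from the drift `(1/2) ∑ L†L`, doubled by the
  -- product formula.
  · filter_upwards [hgraph] with s hs h0 _ hns
    rw [jumpDensity_of_notMem _ _ hns, ← hleft s h0,
      drivingMeasure_real_singleton_of_notMem h0 hns, zero_mul, add_zero]
    simp only [G, jumpDensity_of_notMem _ _ hns, hrate]
    have hI := re_inner_I_smul_eq_zero hH hs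
    have hLL : ∀ α, (⟪u s, ContinuousLinearMap.adjoint (L α) (L α (u s))⟫_ℂ).re
        = ‖L α (u s)‖ ^ 2 := fun α => by
      rw [ContinuousLinearMap.adjoint_inner_right]
      exact re_inner_self_eq _
    have hhalf : (⟪u s, (1 / 2 : ℂ) • ∑ α, ContinuousLinearMap.adjoint (L α) (L α (u s))⟫_ℂ).re
        = 1 / 2 * ∑ α, ‖L α (u s)‖ ^ 2 := by
      rw [inner_smul_right, inner_sum, ← Finset.sum_congr rfl fun α _ => hLL α, ← Complex.re_sum,
        show (1 / 2 : ℂ) = ((1 / 2 : ℝ) : ℂ) by norm_num, Complex.re_ofReal_mul]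
    simp only [f, d, ← hcont s h0 hns, inner_sub_right, inner_neg_right, inner_add_right,
      Complex.sub_re, Complex.neg_re, Complex.add_re, hI, hhalf, inner_sum, Complex.re_sum,
      Finset.sum_add_distrib, ← Finset.mul_sum]
    ring

theorem SolvesUnravelling.normSqPath_eq (hH : IsSelfAdjoint H) (hn : IsSimpleFamily n)
    (hu : SolvesUnravelling H L φ₀ n u) (t : ℝ≥0) :
    normSqPath u t = ‖φ₀‖ ^ 2 + ∑ α, compIntegral (n α)
      (fun s => ratePath (L α) u s * Function.leftLim (normSqPath u) s) t := by
  rw [hn.sum_compIntegral_eq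
    fun α => compIntegrable_ratePath_mul (L α) hu.1 (hn.finite α) t]
  exact hu.normSqPath_eq_integral hH hn t

theorem SolvesUnravelling.isDoleansDade (hH : IsSelfAdjoint H) (hn : IsSimpleFamily n)
    (hu : SolvesUnravelling H L φ₀ n u) (hφ₀ : ‖φ₀‖ = 1) :
    IsDoleansDade (fun t => ∑ α, compIntegral (n α) (ratePath (L α) u) t) (normSqPath u) := by
  have hm : ∀ α, StronglyMeasurable (ratePath (L α) u) := fun α =>
    stronglyMeasurable_ratePath (L α) hu.1
  have hi : ∀ α t, CompIntegrable (n α) (ratePath (L α) u) t := fun α t =>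
    compIntegrable_ratePath (L α) hu.1 (hn.finite α) t
  refine isDoleansDade_of_density
    (g := jumpDensity n (fun α => ratePath (L α) u) (fun s => -∑ α, ratePath (L α) u s))
    (hn.stronglyMeasurable_jumpDensity hm (Finset.stronglyMeasurable_fun_sum _ fun α _ => hm α).neg)
    (fun t => hn.integrableOn_jumpDensity (fun α => (hi α t).1)
      (integrable_finsetSum _ fun α _ => (hi α t).2).neg)
    (fun t => hn.sum_compIntegral_eq fun α => hi α t) (isCadlag_normSqPath hu.1) fun t => ?_
  rw [hu.normSqPath_eq_integral hH hn t, hφ₀, one_pow]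
  -- The factor `z_-` comes out of the jump values and the drift alike, so the two densities agree
  -- pointwise.
  congr 2
  ext s
  by_cases hs : s ∈ ⋃ α, jumpTimes (n α)
  · obtain ⟨α, hα⟩ := mem_iUnion.1 hs
    rw [hn.jumpDensity_of_mem _ _ hα, hn.jumpDensity_of_mem _ _ hα, mul_comm]
  · rw [jumpDensity_of_notMem _ _ hs, jumpDensity_of_notMem _ _ hs, ← Finset.sum_mul]
    ring

end Unravelling

theorem lemma1 {Ω : Type*} [MeasurableSpace Ω] (P : Measure Ω) [IsProbabilityMeasure P]
    {𝓗 : Type*} [NormedAddCommGroup 𝓗] [InnerProductSpace ℂ 𝓗] [CompleteSpace 𝓗]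
    {ι : Type*} [Fintype ι]
    (H : 𝓗 →ₗ.[ℂ] 𝓗) (hH : IsSelfAdjoint H) (L : ι → 𝓗 →L[ℂ] 𝓗)
    (N : ι → Ω → Measure ℝ≥0) (hN : IsStandardPoissonFamily N P)
    (φ₀ : 𝓗) (ψ : ℝ≥0 → Ω → 𝓗)
    (hψ : ∀ᵐ ω ∂P, SolvesUnravelling H L φ₀ (fun α => N α ω) (fun t => ψ t ω)) :
    -- the equation `d⟨ψ|ψ⟩ = ∑ α, R_α ⟨ψ|ψ⟩ dÑ_α`, in integrated form
    (∀ᵐ ω ∂P, ∀ t,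
      (∀ α, CompIntegrable (N α ω) (fun s => ratePath (L α) (fun r => ψ r ω) s
          * Function.leftLim (normSqPath (fun r => ψ r ω)) s) t) ∧
      normSqPath (fun r => ψ r ω) t = ‖φ₀‖ ^ 2
        + ∑ α, compIntegral (N α ω) (fun s => ratePath (L α) (fun r => ψ r ω) s
            * Function.leftLim (normSqPath (fun r => ψ r ω)) s) t) ∧
    -- the driving process `X_t = ∑ α, ∫_{(0,t]} R_α(s-) dÑ_α(s)` is well defined
    (∀ᵐ ω ∂P, ∀ t α, CompIntegrable (N α ω) (ratePath (L α) (fun r => ψ r ω)) t) ∧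
    -- for a normalized initial state, `⟨ψ|ψ⟩ = ℰ(X)`
    (‖φ₀‖ = 1 → ∀ᵐ ω ∂P, IsDoleansDade
      (fun t => ∑ α, compIntegral (N α ω) (ratePath (L α) (fun r => ψ r ω)) t)
      (normSqPath (fun r => ψ r ω))) := by

  have hgood := hN.ae_isSimpleFamily
  refine ⟨?_, ?_, fun hφ₀ => ?_⟩
  · filter_upwards [hgood, hψ] with ω hn hu t
    exact ⟨fun α => compIntegrable_ratePath_mul (L α) hu.1 (hn.finite α) t,
      hu.normSqPath_eq hH hn t⟩
  · filter_upwards [hgood, hψ] with ω hn hu t α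
    exact compIntegrable_ratePath (L α) hu.1 (hn.finite α) t
  · filter_upwards [hgood, hψ] with ω hn hu
    exact hu.isDoleansDade hH hn hφ₀
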